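/- Let $(\Omega,\mathcal F,\mathbb P)$ be a probability space and $\theta:\Omega\to\Omega$ an invertible (bijective, bimeasurable), ergodic, $\mathbb P$-preserving transformation. Let $d\ge 1$, let $M_d$ be the complex $d\times d$ matrices with trace norm $\|X\|_1=\operatorname{tr}\sqrt{X^\dagger X}$, and let $\mathcal S=\{\rho\in M_d:\rho\ge 0,\ \operatorname{tr}\rho=1\}$. Let $\mathcal A$ be a finite set and, for $a\in\mathcal A$, let $\omega\mapsto\mathcal T_{a;\omega}$ be a measurable map into the linear maps $M_d\to M_d$ such that, for $\mathbb P$-a.e. $\omega$, $\mathcal V_\omega=\{\mathcal T_{a;\omega}\}_{a\in\mathcal A}$ is a quantum instrument: every $\mathcal T_{a;\omega}$ is completely positive and trace-non-increasing, and $\Phi_\omega=\sum_{a}\mathcal T_{a;\omega}$ is trace-preserving. Put $\Phi^{(n)}_\omega=\Phi_{\theta^n\omega}\circ\cdots\circ\Phi_{\theta\omega}$. For $\rho\in\mathcal S$ let $\mathbb Q_{\rho;\omega}$ (defined for $\mathbb P$-a.e. $\omega$) be the probability measure on $\mathcal A^{\mathbb N}$ with $$\mathbb Q_{\rho;\omega}(\{a_1\}\times\cdots\times\{a_n\}\times\mathcal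 A\times\cdots)=\operatorname{tr}\bigl[(\mathcal T_{a_n;\theta^n\omega}\circ\cdots\circ\mathcal T_{a_1;\theta\omega})(\rho)\bigr].$$ A random state is a measurable map $\Omega\to\mathcal S$; a random state $s$ is dynamically stationary if, for $\mathbb P$-a.e. $\omega$, $\Phi^{(n)}_\omega(s(\omega))=s(\theta^n\omega)$ for all $n\in\mathbb N$. Theorem. Assume (ESP): for $\mathbb P$-a.e. $\omega$ there is $N_0(\omega)\in\mathbb N$ such that for all $n\ge N_0(\omega)$ the map $\Phi^{(n)}_\omega$ is strictly positive, i.e. maps every nonzero positive semidefinite matrix to a positive definite one. Then there is a dynamically stationary state $s$, and it is unique up to $\mathbb P$-a.e. equality. Moreover, for every random state $\vartheta$, $$\mathbb Q_{\vartheta(\omega);\omega}\ll\mathbb Q_{s(\omega);\omega}\qquad\text{for }\mathbb P\text{-a.e. }\omega .$$ For $k\in\mathbb Z$ let $\mathcal F_k=\sigma(\omega\mapsto\mathcal V_{\theta^j\omega}: j\in\mathbb Z,\ j\le k)$ and $\mathcal F^k=\sigma(\omega\mapsto\mathcal V_{\theta^j\omega}: j\in\mathbb Z,\ j\ge k)$,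 and let $\rho(n)=\sup_{k\ge1}\sup|\mathrm{Corr}_{\mathbb P}(U,V)|$, the inner supremum being over square-integrable $U,V$ of positive variance, $U$ being $\mathcal F_k$-measurable and $V$ being $\mathcal F^{k+n}$-measurable. For a random state $\vartheta$ let $$\beta_n(\vartheta)=\mathbb E_{\mathbb P}\bigl\|\Phi^{(n)}_\omega(\vartheta(\omega))-s(\theta^n\omega)\bigr\|_1 .$$ If in addition $\rho(n)\to0$, then annealed forgetting holds with the state $s$: for every $\delta>0$ there is a deterministic sequence $(r_n)_{n\ge1}\subseteq[0,\infty)$ with $\sum_{n\ge1}r_n^{\delta/(2+\delta)}<\infty$ and $\beta_n(\vartheta)\le r_n$ for all $n\ge1$ and all random states $\vartheta$. Moreover the rate is polynomial of every order: for every $p\in\mathbb N$ there is a constant $C_p>0$ such that $\beta_n(\vartheta)\le C_p\,n^{-p}$ for all $n\ge1$ and all random states $\vartheta$. -/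

import Mathlib

/-! Disordered quantum instruments on `ℂ^d`, their non-selective cocycle, quenched outcome laws,
mixing coefficients and annealed forgetting. -/

open MeasureTheory ProbabilityTheory Filter Topology
open scoped ENNReal ComplexOrder

noncomputable section

namespace DisorderedInstrument

/-- `M_d`, the `d × d` complex matrices, identified with `B(ℂ^d)`. -/
abbrev Mat (d : ℕ) : Type := Matrix (Fin d) (Fin d) ℂ

/-- Linear maps `M_d → M_d`. -/
abbrev Superop (d : ℕ) : Type := Mat d →ₗ[ℂ] Mat d

/-- The Borel `σ`-algebra on `M_d` (the product of the Borel `σ`-algebras of the entries). -/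
instance instMeasurableSpaceMat (d : ℕ) : MeasurableSpace (Mat d) :=
  inferInstanceAs (MeasurableSpace (Fin d → Fin d → ℂ))

instance instBorelSpaceMat (d : ℕ) : BorelSpace (Mat d) :=
  inferInstanceAs (BorelSpace (Fin d → Fin d → ℂ))

/-- The state space: density matrices. -/
abbrev State (d : ℕ) : Type := {ρ : Mat d // ρ.PosSemidef ∧ ρ.trace = 1}

section CP

open scoped Matrix.Norms.L2Operator MatrixOrder CStarAlgebra

/-- `φ` is completely positive (Mathlib's notion, for the C⋆-algebra `M_d`, whose order is the
Loewner order). -/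
def CompletelyPositive {d : ℕ} (φ : Superop d) : Prop :=
  ∃ ψ : Mat d →CP Mat d, ∀ X : Mat d, ψ X = φ X

lemma CompletelyPositive.posSemidef {d : ℕ} {φ : Superop d} (h : CompletelyPositive φ)
    {X : Mat d} (hX : X.PosSemidef) : (φ X).PosSemidef := by
  obtain ⟨ψ, hψ⟩ := h
  rw [← hψ, ← Matrix.nonneg_iff_posSemidef]
  exact map_nonneg ψ (Matrix.nonneg_iff_posSemidef.mpr hX)

end CP

section TraceNorm

open scoped MatrixOrder

/-- The trace norm `‖X‖₁ = tr |X|`, `|X| = √(X† X)`. -/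
def traceNorm {d : ℕ} (X : Mat d) : ℝ := (CFC.abs X).trace.re

end TraceNorm

section Extension

variable {A : Type*} [MeasurableSpace A]

/-- The cylinder set of sequences whose first `n` entries agree with those of `a`. -/
def cylinder (n : ℕ) (a : ℕ → A) : Set (ℕ → A) := {x | ∀ i < n, x i = a i}

/-- `Q` is a probability measure on `A^ℕ` with cylinder probabilities `p`. -/
def HasCylinderProbs (p : ℕ → (ℕ → A) → ℝ≥0∞) (Q : Measure (ℕ → A)) : Prop :=
  IsProbabilityMeasure Q ∧ ∀ (n : ℕ) (a : ℕ → A), Q (cylinder n a) = p n a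

lemma measurableSet_cylinder [DiscreteMeasurableSpace A] (n : ℕ) (a : ℕ → A) : MeasurableSet (cylinder n a) := by
  have : cylinder n a = ⋂ i ∈ Finset.range n, (fun x : ℕ → A => x i) ⁻¹' {a i} := by
    ext x; simp [cylinder]
  rw [this]
  exact Finset.measurableSet_biInter _ fun i _ =>
    (measurable_pi_apply i) (MeasurableSet.of_discrete)

/-- Kolmogorov extension for a finite alphabet. -/
lemma exists_hasCylinderProbs [Fintype A] [DiscreteMeasurableSpace A] [Nonempty A]
    (p : ℕ → (ℕ → A) → ℝ≥0∞)
    (hfin : ∀ n a, p n a ≠ ∞) (h0 : ∀ a, p 0 a = 1)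
    (hdep : ∀ n (a b : ℕ → A), (∀ i < n, a i = b i) → p n a = p n b)
    (hsum : ∀ n (a : ℕ → A), ∑ b, p (n + 1) (fun i => if i = n then b else a i) = p n a) :
    ∃ Q, HasCylinderProbs p Q := by
  classical
  obtain ⟨a₀⟩ := ‹Nonempty A›
  let ext' : (n : ℕ) → ((i : Finset.Iic n) → A) → ℕ → A := fun n h i =>
    if hi : i + 1 ≤ n then h ⟨i + 1, Finset.mem_Iic.2 hi⟩ else a₀
  let w : (n : ℕ) → ((i : Finset.Iic n) → A) → A → ℝ≥0∞ := fun n h b =>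
    p (n + 1) (fun i => if i = n then b else ext' n h i)
  let κ : (n : ℕ) → Kernel ((i : Finset.Iic n) → A) A := fun n =>
    { toFun := fun h => if p n (ext' n h) = 0 then Measure.dirac a₀ else
        ∑ b, (w n h b / p n (ext' n h)) • Measure.dirac b
      measurable' := Measurable.of_discrete }
  have hκ : ∀ n h, κ n h = if p n (ext' n h) = 0 then Measure.dirac a₀ else
        ∑ b, (w n h b / p n (ext' n h)) • Measure.dirac b := fun _ _ => rfl
  have hw : ∀ n h, ∑ b, w n h b = p n (ext' n h) := fun n h => hsum n _
  have hκm : ∀ n, IsMarkovKernel (κ n) := by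
    intro n
    refine ⟨fun h => ⟨?_⟩⟩
    rw [hκ]
    split_ifs with hz
    · simp
    · simp only [Measure.coe_finsetSum, Finset.sum_apply, Measure.smul_apply, measure_univ,
        smul_eq_mul, mul_one, ENNReal.div_eq_inv_mul]
      rw [← Finset.mul_sum, hw, ENNReal.inv_mul_cancel hz (hfin _ _)]
  have hκs : ∀ n h c, p n (ext' n h) * κ n h {c} = w n h c := by
    intro n h c
    rw [hκ]
    split_ifs with hz
    · have : ∑ b, w n h b = 0 := by rw [hw, hz]
      rw [hz, zero_mul, (Finset.sum_eq_zero_iff.1 this) c (Finset.mem_univ c)]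
    · have : (∑ b, (w n h b / p n (ext' n h)) • Measure.dirac b : Measure A) {c}
          = w n h c / p n (ext' n h) := by
        simp only [Measure.coe_finsetSum, Finset.sum_apply, Measure.smul_apply, smul_eq_mul]
        rw [Finset.sum_eq_single c]
        · simp
        · intro b _ hb
          simp [hb]
        · simp
      rw [this, ENNReal.mul_div_cancel hz (hfin _ _)]
  let x₀ : (i : Finset.Iic 0) → A := fun _ => a₀
  let μ : Measure (ℕ → A) := Kernel.traj (X := fun _ : ℕ => A) κ 0 x₀
  let hist : (n : ℕ) → (ℕ → A) → (i : Finset.Iic n) → A := fun n a i =>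
    if (i : ℕ) = 0 then a₀ else a (i - 1)
  have hext : ∀ n a, ∀ i < n, ext' n (hist n a) i = a i := by
    intro n a i hi
    have hi' : i + 1 ≤ n := hi
    have hi'' : ¬ n ≤ i := by omega
    simp [ext', hist, hi'']
  clear_value κ
  have key : ∀ n a, μ {x : ℕ → A | Preorder.frestrictLe (π := fun _ : ℕ => A) n x = hist n a} = p n a := by
    intro n
    induction n with
    | zero =>
      intro a
      rw [h0]
      have h1 : (Kernel.traj (X := fun _ : ℕ => A) κ 0 x₀).map (Preorder.frestrictLe (π := fun _ : ℕ => A) 0) = Measure.dirac x₀ := by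
        rw [Kernel.traj_map_frestrictLe_apply, Kernel.partialTraj_self, Kernel.id_apply]
      have h2 : hist 0 a = x₀ := by
        funext i
        have : (i : ℕ) = 0 := by simpa using Finset.mem_Iic.1 i.2
        simp [hist, x₀, this]
      have h3 : {x : ℕ → A | Preorder.frestrictLe (π := fun _ : ℕ => A) 0 x = hist 0 a}
          = (Preorder.frestrictLe (π := fun _ : ℕ => A) 0) ⁻¹' {x₀} := by
        ext x; simp [h2]
      rw [h3, ← Measure.map_apply (Preorder.measurable_frestrictLe (X := fun _ : ℕ => A) 0) MeasurableSet.of_discrete, h1]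
      simp
    | succ n ih =>
      intro a
      have h1 := Kernel.partialTraj_compProd_eq_map_traj (X := fun _ : ℕ => A) (κ := κ) (Nat.zero_le n) (x₀ := x₀)
      have h3 : {x : ℕ → A | Preorder.frestrictLe (π := fun _ : ℕ => A) (n + 1) x = hist (n + 1) a}
          = (fun x => (Preorder.frestrictLe (π := fun _ : ℕ => A) n x, x (n + 1))) ⁻¹' ({hist n a} ×ˢ {a n}) := by
        ext x
        simp only [Set.mem_ofPred_eq, Set.mem_preimage, Set.mem_prod, Set.mem_singleton_iff]
        constructor
        · intro h
          refine ⟨?_, ?_⟩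
          · funext i
            have := congrFun h ⟨i, Finset.mem_Iic.2 ((Finset.mem_Iic.1 i.2).trans n.le_succ)⟩
            simpa [hist] using this
          · have := congrFun h ⟨n + 1, Finset.mem_Iic.2 le_rfl⟩
            simpa [hist] using this
        · rintro ⟨h, h'⟩
          funext i
          rcases Nat.lt_or_ge (i : ℕ) (n + 1) with hi | hi
          · have := congrFun h ⟨i, Finset.mem_Iic.2 (Nat.lt_succ_iff.1 hi)⟩
            simpa [hist] using this
          · have hi' : (i : ℕ) = n + 1 := le_antisymm (Finset.mem_Iic.1 i.2) hi
            simp [hist, hi', h']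
      have hm : Measurable (fun x : ℕ → A => (Preorder.frestrictLe (π := fun _ : ℕ => A) n x, x (n + 1))) :=
        (Preorder.measurable_frestrictLe (X := fun _ : ℕ => A) n).prodMk (measurable_pi_apply _)
      have h4 : Kernel.partialTraj (X := fun _ : ℕ => A) κ 0 n x₀ {hist n a} = p n a := by
        rw [← Kernel.traj_map_frestrictLe_apply,
          Measure.map_apply (Preorder.measurable_frestrictLe (X := fun _ : ℕ => A) n) MeasurableSet.of_discrete]
        exact ih a
      rw [h3]
      change (Kernel.traj (X := fun _ : ℕ => A) κ 0 x₀) _ = _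
      rw [← Measure.map_apply hm (MeasurableSet.of_discrete.prod MeasurableSet.of_discrete), ← h1,
        Measure.compProd_apply_prod MeasurableSet.of_discrete MeasurableSet.of_discrete,
        lintegral_singleton, h4, mul_comm]
      have h5 : p n a = p n (ext' n (hist n a)) :=
        hdep n _ _ fun i hi => (hext n a i hi).symm
      rw [h5, hκs]
      refine hdep _ _ _ fun i hi => ?_
      split_ifs with hin
      · rw [hin]
      · exact hext n a i (by omega)
  have hs : Measurable (fun (x : ℕ → A) (i : ℕ) => x (i + 1)) :=
    measurable_pi_lambda _ fun i => measurable_pi_apply _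
  refine ⟨μ.map (fun x i => x (i + 1)), Measure.isProbabilityMeasure_map hs.aemeasurable,
    fun n a => ?_⟩
  rw [Measure.map_apply hs (measurableSet_cylinder n a), ← key n a]
  have hae : ∀ᵐ x ∂μ, x 0 = a₀ := by
    have h1 : μ {x : ℕ → A | Preorder.frestrictLe (π := fun _ : ℕ => A) 0 x = hist 0 (fun _ => a₀)} = 1 := by
      have h := key 0 (fun _ => a₀)
      rw [h0] at h
      exact h
    have hμ : IsProbabilityMeasure μ :=
      inferInstanceAs (IsProbabilityMeasure (Kernel.traj (X := fun _ : ℕ => A) κ 0 x₀))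
    have hm0 : MeasurableSet
        {x : ℕ → A | Preorder.frestrictLe (π := fun _ : ℕ => A) 0 x = hist 0 (fun _ => a₀)} :=
      (Preorder.measurable_frestrictLe (X := fun _ : ℕ => A) 0)
        (MeasurableSet.of_discrete (s := {hist 0 (fun _ => a₀)}))
    have h2 : μ {x : ℕ → A | Preorder.frestrictLe (π := fun _ : ℕ => A) 0 x = hist 0 (fun _ => a₀)}ᶜ = 0 :=
      (prob_compl_eq_zero_iff hm0).2 h1
    have h3 : ∀ᵐ x ∂μ, Preorder.frestrictLe (π := fun _ : ℕ => A) 0 x = hist 0 (fun _ => a₀) := h2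
    filter_upwards [h3] with x hx
    have := congrFun hx ⟨0, Finset.mem_Iic.2 le_rfl⟩
    simpa [hist] using this
  refine measure_congr ?_
  filter_upwards [hae] with x hx
  refine propext ⟨fun h => ?_, fun h i hi => ?_⟩
  · funext i
    rcases Nat.eq_zero_or_pos (i : ℕ) with hi | hi
    · simp [hist, hi, hx]
    · have hle := Finset.mem_Iic.1 i.2
      have := h ((i : ℕ) - 1) (by omega)
      have e : (i : ℕ) - 1 + 1 = i := by omega
      simp only [e] at this
      simp [hist, hi.ne', this]
  · have := congrFun h ⟨i + 1, Finset.mem_Iic.2 hi⟩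
    simpa [hist] using this

/-- A law on `A^ℕ` is determined by its cylinder probabilities. -/
lemma HasCylinderProbs.unique [Fintype A] [DiscreteMeasurableSpace A]
    {p : ℕ → (ℕ → A) → ℝ≥0∞} {Q Q' : Measure (ℕ → A)}
    (h : HasCylinderProbs p Q) (h' : HasCylinderProbs p Q') : Q = Q' := by
  classical
  have := h.1
  have := h'.1
  refine ext_of_generate_finite {s | ∃ n a, s = cylinder n a} ?_ ?_ ?_ (by simp)
  · apply le_antisymm
    · rw [MeasurableSpace.pi]
      refine iSup_le fun i => ?_
      rintro _ ⟨t, -, rfl⟩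
      have : (fun x : ℕ → A => x i) ⁻¹' t
          = ⋃ w ∈ {w : Fin (i + 1) → A | w (Fin.last i) ∈ t},
              cylinder (i + 1) (fun j => if hj : j < i + 1 then w ⟨j, hj⟩ else w 0) := by
        ext x
        simp only [Set.mem_preimage, Set.mem_ofPred_eq, Set.mem_iUnion, exists_prop, cylinder]
        constructor
        · intro hx
          exact ⟨fun j => x j, by simpa using hx, fun j hj => by simp [hj]⟩
        · rintro ⟨w, hw, hx⟩
          have := hx i (Nat.lt_succ_self i)
          simp only [Nat.lt_succ_self, dif_pos] at this
          rw [this]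
          exact hw
      rw [this]
      refine MeasurableSet.biUnion (Set.to_countable _) fun w _ => ?_
      exact MeasurableSpace.measurableSet_generateFrom ⟨_, _, rfl⟩
    · refine MeasurableSpace.generateFrom_le ?_
      rintro _ ⟨n, a, rfl⟩
      exact measurableSet_cylinder n a
  · rintro _ ⟨n, a, rfl⟩ _ ⟨m, b, rfl⟩ ⟨y, hy, hy'⟩
    refine ⟨max n m, y, ?_⟩
    ext x
    simp only [cylinder, Set.mem_inter_iff, Set.mem_ofPred_eq] at hy hy' ⊢
    constructor
    · rintro ⟨h₁, h₂⟩ i hi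
      rcases lt_max_iff.1 hi with h | h
      · rw [h₁ i h, hy i h]
      · rw [h₂ i h, hy' i h]
    · intro hx
      exact ⟨fun i hi => by rw [hx i (lt_max_of_lt_left hi), hy i hi],
        fun i hi => by rw [hx i (lt_max_of_lt_right hi), hy' i hi]⟩
  · rintro _ ⟨n, a, rfl⟩
    rw [h.2, h'.2]

end Extension

/-- A quantum instrument on `ℂ^d` with outcome set `A`. -/
structure IsInstrument {d : ℕ} {A : Type*} [Fintype A] (V : A → Superop d) : Prop where
  completelyPositive : ∀ a, CompletelyPositive (V a)
  trace_nonincreasing : ∀ a (X : Mat d), X.PosSemidef → (V a X).trace.re ≤ X.trace.re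
  trace_preserving : ∀ X : Mat d, (∑ a, V a X).trace = X.trace

/-- A random instrument `ω ↦ (T_{a;ω})_a`: measurable in `ω` (tested on each matrix, which is
measurability into the finite-dimensional space of superoperators), and almost surely an
instrument. -/
structure IsRandomInstrument {Ω : Type*} [MeasurableSpace Ω] (P : Measure Ω) {d : ℕ} {A : Type*}
    [Fintype A] (T : A → Ω → Superop d) : Prop where
  measurable : ∀ a (X : Mat d), Measurable fun ω => T a ω X
  isInstrument : ∀ᵐ ω ∂P, IsInstrument fun a => T a ω

section Dynamics

variable {Ω : Type*} {d : ℕ} {A : Type*}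

/-- The non-selective cocycle
`Φ^{(n)}_ω = Φ_{θ^n ω} ∘ ⋯ ∘ Φ_{θ ω}`, where `Φ_ω = ∑ a, T_{a;ω}`; `Φ^{(0)}_ω` is the identity. -/
def cocycle [Fintype A] (θ : Ω → Ω) (T : A → Ω → Superop d) : ℕ → Ω → Superop d
  | 0, _ => LinearMap.id
  | n + 1, ω => (∑ a, T a (θ^[n + 1] ω)) ∘ₗ cocycle θ T n ω

/-- `φ` maps every nonzero positive semidefinite matrix to a positive definite one. -/
def StrictlyPositive (φ : Superop d) : Prop :=
  ∀ X : Mat d, X.PosSemidef → X ≠ 0 → (φ X).PosDef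

/-- The selective composition `T_{a_n;θ^n ω} ∘ ⋯ ∘ T_{a_1;θ ω}`; the outcome `a_k` of the `k`-th
measurement is stored as `a (k - 1)`, so only the first `n` entries of `a` matter. -/
def selective (θ : Ω → Ω) (T : A → Ω → Superop d) (ω : Ω) (a : ℕ → A) : ℕ → Superop d
  | 0 => LinearMap.id
  | n + 1 => T (a n) (θ^[n + 1] ω) ∘ₗ selective θ T ω a n

/-- The quenched probability `tr ((T_{a_n;θ^n ω} ∘ ⋯ ∘ T_{a_1;θ ω}) ρ)` of the first `n` outcomes
of `a`. -/
def cylinderProb (θ : Ω → Ω) (T : A → Ω → Superop d) (ω : Ω) (ρ : State d) (n : ℕ) (a : ℕ → A) :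
    ℝ≥0∞ :=
  ENNReal.ofReal (selective θ T ω a n (ρ : Mat d)).trace.re

open Classical in
/-- The quenched outcome law `Q_{ρ;ω}`: the unique probability measure on `A^ℕ` with the cylinder
probabilities `cylinderProb θ T ω ρ`. It exists whenever `V_{θ^k ω}` is an instrument for all
`k ≥ 1` (see `quenchedLaw_spec` and `quenchedLaw_eq`), which is the case for almost every `ω`. -/
def quenchedLaw [MeasurableSpace A] (θ : Ω → Ω) (T : A → Ω → Superop d) (ω : Ω) (ρ : State d) :
    Measure (ℕ → A) :=
  if h : ∃ Q, HasCylinderProbs (cylinderProb θ T ω ρ) Q then h.choose else 0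

lemma selective_congr (θ : Ω → Ω) (T : A → Ω → Superop d) (ω : Ω) {a b : ℕ → A} (n : ℕ)
    (h : ∀ i < n, a i = b i) : selective θ T ω a n = selective θ T ω b n := by
  induction n with
  | zero => rfl
  | succ n ih =>
    simp only [selective]
    rw [h n (Nat.lt_succ_self n), ih fun i hi => h i (hi.trans (Nat.lt_succ_self n))]

lemma selective_posSemidef [Fintype A] (θ : Ω → Ω) (T : A → Ω → Superop d) (ω : Ω)
    (hT : ∀ k, 1 ≤ k → IsInstrument fun a => T a (θ^[k] ω)) (a : ℕ → A) (n : ℕ)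
    {X : Mat d} (hX : X.PosSemidef) : (selective θ T ω a n X).PosSemidef := by
  induction n with
  | zero => exact hX
  | succ n ih => exact ((hT (n + 1) (Nat.succ_pos n)).completelyPositive (a n)).posSemidef ih

lemma quenchedLaw_spec [Fintype A] [MeasurableSpace A] [DiscreteMeasurableSpace A]
    (θ : Ω → Ω) (T : A → Ω → Superop d) (ω : Ω)
    (hT : ∀ k, 1 ≤ k → IsInstrument fun a => T a (θ^[k] ω)) (ρ : State d) :
    HasCylinderProbs (cylinderProb θ T ω ρ) (quenchedLaw θ T ω ρ) := by
  have hA : Nonempty A := by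
    by_contra hne
    rw [not_nonempty_iff] at hne
    have := (hT 1 le_rfl).trace_preserving ρ
    rw [ρ.2.2] at this
    simp at this
  have hex : ∃ Q, HasCylinderProbs (cylinderProb θ T ω ρ) Q := by
    refine exists_hasCylinderProbs _ (fun n a => ENNReal.ofReal_ne_top) (fun a => ?_)
      (fun n a b h => ?_) (fun n a => ?_)
    · simp [cylinderProb, selective, ρ.2.2]
    · simp only [cylinderProb, selective_congr θ T ω n h]
    · simp only [cylinderProb]
      rw [← ENNReal.ofReal_sum_of_nonneg]
      · congr 1
        have h1 := (hT (n + 1) (Nat.succ_pos n)).trace_preserving (selective θ T ω a n ρ)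
        rw [← h1, Matrix.trace_sum, Complex.re_sum]
        refine Finset.sum_congr rfl fun b _ => ?_
        simp only [selective, if_true, LinearMap.comp_apply]
        rw [selective_congr θ T ω n (b := a) fun i hi => by simp [hi.ne]]
      · intro b _
        exact (Complex.le_def.1 (selective_posSemidef θ T ω hT _ (n + 1) ρ.2.1).trace_nonneg).1
  rw [quenchedLaw, dif_pos hex]
  exact hex.choose_spec

lemma quenchedLaw_eq [Fintype A] [MeasurableSpace A] [DiscreteMeasurableSpace A]
    (θ : Ω → Ω) (T : A → Ω → Superop d) (ω : Ω)
    (hT : ∀ k, 1 ≤ k → IsInstrument fun a => T a (θ^[k] ω)) (ρ : State d)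
    {Q : Measure (ℕ → A)} (hQ : HasCylinderProbs (cylinderProb θ T ω ρ) Q) :
    Q = quenchedLaw θ T ω ρ :=
  hQ.unique (quenchedLaw_spec θ T ω hT ρ)

end Dynamics

section Stochastic

variable {Ω : Type*} [MeasurableSpace Ω] {d : ℕ} {A : Type*} [Fintype A]

/-- Eventual strict positivity (ESP) of the non-selective cocycle. -/
def EventuallyStrictlyPositive (P : Measure Ω) (θ : Ω → Ω) (T : A → Ω → Superop d) : Prop :=
  ∀ᵐ ω ∂P, ∃ N₀ : ℕ, ∀ n ≥ N₀, StrictlyPositive (cocycle θ T n ω)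

/-- `s` is a (measurable) random state with `Φ^{(n)}_ω (s ω) = s (θ^n ω)` for all `n`, almost
surely. -/
def DynamicallyStationary (P : Measure Ω) (θ : Ω → Ω) (T : A → Ω → Superop d)
    (s : Ω → State d) : Prop :=
  Measurable s ∧ ∀ᵐ ω ∂P, ∀ n : ℕ, cocycle θ T n ω (s ω : Mat d) = (s (θ^[n] ω) : Mat d)

/-- `β_n(ϑ) = 𝔼 ‖Φ^{(n)}_ω (ϑ ω) - s (θ^n ω)‖₁`. -/
def forgettingCoeff (P : Measure Ω) (θ : Ω → Ω) (T : A → Ω → Superop d) (s ϑ : Ω → State d)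
    (n : ℕ) : ℝ≥0∞ :=
  ∫⁻ ω, ENNReal.ofReal
    (traceNorm (cocycle θ T n ω (ϑ ω : Mat d) - (s (θ^[n] ω) : Mat d))) ∂P

/-- The annealed forgetting property with exponent parameter `δ`, witnessed by the random
state `s`. -/
def AnnealedForgetting (P : Measure Ω) (θ : Ω → Ω) (T : A → Ω → Superop d) (δ : ℝ)
    (s : Ω → State d) : Prop :=
  DynamicallyStationary P θ T s ∧
    ∃ r : ℕ → ℝ, (∀ n, 0 ≤ r n) ∧
      Summable (fun n : ℕ => r (n + 1) ^ (δ / (2 + δ))) ∧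
      ∀ ϑ : Ω → State d, Measurable ϑ → ∀ n, 1 ≤ n →
        forgettingCoeff P θ T s ϑ n ≤ ENNReal.ofReal (r n)

end Stochastic

section Mixing

variable {Ω : Type*} {d : ℕ} {A : Type*}

/-- `σ(ω ↦ V_{θ^j ω})`, the `σ`-algebra generated by the instrument at time `j ∈ ℤ`. -/
@[reducible]
def instrumentSigma [MeasurableSpace Ω] (θ : Ω ≃ᵐ Ω) (T : A → Ω → Superop d) (j : ℤ) :
    MeasurableSpace Ω :=
  ⨆ (a : A) (X : Mat d),
    MeasurableSpace.comap (fun ω => T a (((θ.toEquiv : Equiv.Perm Ω) ^ j) ω) X) inferInstance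

/-- `F_k = σ(V_{θ^j ω} : j ≤ k)`. -/
@[reducible]
def pastSigma [MeasurableSpace Ω] (θ : Ω ≃ᵐ Ω) (T : A → Ω → Superop d) (k : ℤ) :
    MeasurableSpace Ω :=
  ⨆ (j : ℤ) (_ : j ≤ k), instrumentSigma θ T j

/-- `F^k = σ(V_{θ^j ω} : j ≥ k)`. -/
@[reducible]
def futureSigma [MeasurableSpace Ω] (θ : Ω ≃ᵐ Ω) (T : A → Ω → Superop d) (k : ℤ) :
    MeasurableSpace Ω :=
  ⨆ (j : ℤ) (_ : k ≤ j), instrumentSigma θ T j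

/-- The maximal correlation coefficient of two sub-`σ`-algebras: the supremum of `|Corr(U, V)|` over
non-constant `U ∈ L²(m₁)`, `V ∈ L²(m₂)`. -/
def maxCorr [MeasurableSpace Ω] (P : Measure Ω) (m₁ m₂ : MeasurableSpace Ω) : ℝ≥0∞ :=
  ⨆ (U : Ω → ℝ) (V : Ω → ℝ) (_ : Measurable[m₁] U) (_ : Measurable[m₂] V)
    (_ : MemLp U 2 P) (_ : MemLp V 2 P) (_ : 0 < Var[U; P]) (_ : 0 < Var[V; P]),
    ENNReal.ofReal (|cov[U, V; P]| / (√Var[U; P] * √Var[V; P]))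

/-- `ρ(n) = sup_{k ≥ 1} ρ(F_k, F^{k+n})`. -/
def rhoMixing [MeasurableSpace Ω] (P : Measure Ω) (θ : Ω ≃ᵐ Ω) (T : A → Ω → Superop d) (n : ℕ) :
    ℝ≥0∞ :=
  ⨆ (k : ℕ) (_ : 1 ≤ k), maxCorr P (pastSigma θ T k) (futureSigma θ T (k + n))

end Mixing

end DisorderedInstrument

end

/-!
The argument is a norm-free version of the Dobrushin contraction method. A positive
trace-preserving map whose outputs on states all dominate `ε` (a *minorized* map) sends a
difference of two states to `1 - dε` times a difference of two states
(`IsPTP.contracts_of_minorized`), and such factors multiply under composition (`Contracts.comp`).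
By compactness of the state space a strictly positive map is minorized
(`StrictlyPositive.exists_minorized`), so eventual strict positivity provides a block length `m`
and an `ε` for which the cocycle over a block is minorized with positive probability.

*Stationary state.* By ergodicity and Poincaré recurrence almost every backward orbit meets such
blocks infinitely often, so the pull-back maps `Φ^{(n)}_{θ^{-n}ω}` contract to zero
(`exists_contracts_pow`). Hence `s(ω) = lim Φ^{(n)}_{θ^{-n}ω} ρ` exists, is stationary, and is the
only stationary state, since every stationary state is reproduced by the pull-back maps.

*Domination.* The probability that `Φ^{(n)}_ω` is minorized tends to one, so by invariance of the
measure `s(ω)` is almost surely the image of a state under a minorized map, hence `s(ω) ≥ ε > 0`.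
Then `s(ω)` is a convex combination, with positive weight on `ϑ(ω)`, of `ϑ(ω)` and another state;
the outcome law is affine in the initial state, so the law of `ϑ(ω)` is dominated
(`quenchedLaw_absolutelyContinuous`).

*Forgetting.* Let `f(J)` be the expectation of the product of the contraction factors of the first
`J` blocks (`blockFactor`). Discarding the middle third of `3J` blocks leaves two products with
values in `[0, 1]`, equally distributed and separated by a gap `Jm`; the maximal correlation
coefficient then gives `f(3J) ≤ f(J) (f(J) + ρ(Jm))` (`integral_blockFactor_three_mul_le`). As
`f(1) < 1` and `ρ → 0`, this forces `f → 0`, and then shows that tripling `J` eventually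
multiplies `f` by an arbitrarily small constant: `f` decays faster than every power
(`exists_le_div_pow_of_approx_submultiplicative`). Since `β_n(ϑ)` is at most a constant times
`f(⌊n / m⌋)`, uniformly in `ϑ`, every polynomial rate follows, and with it the summability.
-/

namespace DisorderedInstrument

/-! ### Density matrices -/

variable {d : ℕ}

instance instPolishSpaceMat (d : ℕ) : PolishSpace (Mat d) :=
  inferInstanceAs (PolishSpace (Fin d → Fin d → ℂ))

lemma posSemidef_iff_forall_re {X : Mat d} :
    X.PosSemidef ↔ X.IsHermitian ∧ ∀ v : Fin d → ℂ, 0 ≤ (star v ⬝ᵥ (X.mulVec v)).re := by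
  refine ⟨fun h => ⟨h.1, fun v => h.re_dotProduct_nonneg v⟩, fun h => ?_⟩
  refine Matrix.PosSemidef.of_dotProduct_mulVec_nonneg h.1 fun v => ?_
  rw [Complex.nonneg_iff]
  exact ⟨h.2 v, (h.1.im_star_dotProduct_mulVec_self v).symm⟩

lemma isClosed_posSemidef : IsClosed {X : Mat d | X.PosSemidef} := by
  have : {X : Mat d | X.PosSemidef} = {X : Mat d | X.conjTranspose = X} ∩
      ⋂ v : Fin d → ℂ, {X : Mat d | 0 ≤ (star v ⬝ᵥ (X.mulVec v)).re} := by
    ext X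
    simp [posSemidef_iff_forall_re, Matrix.IsHermitian]
  rw [this]
  refine IsClosed.inter (isClosed_eq (by fun_prop) continuous_id) ?_
  refine isClosed_iInter fun v => isClosed_le continuous_const ?_
  fun_prop

lemma isClosed_isState : IsClosed {X : Mat d | X.PosSemidef ∧ X.trace = 1} :=
  isClosed_posSemidef.inter (isClosed_eq (by fun_prop) continuous_const)

/-- The entries of a density matrix are bounded by one, by positivity of the `2 × 2` principal
minors. -/
lemma State.norm_apply_le (ρ : State d) (i j : Fin d) : ‖(ρ : Mat d) i j‖ ≤ 1 := by
  have hdiag : ∀ k, 0 ≤ (ρ : Mat d) k k := fun k => ρ.2.1.diag_nonneg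
  have hle : ∀ k, ((ρ : Mat d) k k).re ≤ 1 := by
    intro k
    have h1 : ((ρ : Mat d).trace).re = 1 := by rw [ρ.2.2]; rfl
    rw [← h1, Matrix.trace, Complex.re_sum]
    exact Finset.single_le_sum (f := fun k => ((ρ : Mat d).diag k).re)
      (fun k _ => (Complex.nonneg_iff.1 (hdiag k)).1) (Finset.mem_univ k)
  have hdet := (ρ.2.1.submatrix ![i, j]).det_nonneg
  rw [Matrix.det_fin_two] at hdet
  simp only [Matrix.submatrix_apply, Matrix.cons_val_zero, Matrix.cons_val_one] at hdet
  have hji : (ρ : Mat d) j i = star ((ρ : Mat d) i j) := (ρ.2.1.1.apply j i).symm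
  have h2 := (Complex.nonneg_iff.1 hdet).1
  rw [hji, Complex.star_def, Complex.mul_conj, Complex.sub_re, Complex.mul_re, Complex.ofReal_re,
    Complex.normSq_eq_norm_sq] at h2
  have hi := Complex.nonneg_iff.1 (hdiag i)
  have hj := Complex.nonneg_iff.1 (hdiag j)
  rw [← hi.2, ← hj.2] at h2
  have h3 : ((ρ : Mat d) i i).re * ((ρ : Mat d) j j).re ≤ 1 :=
    mul_le_one₀ (hle i) hj.1 (hle j)
  exact (sq_le_one_iff₀ (norm_nonneg _)).1 (by linarith)

instance instCompactSpaceState (d : ℕ) : CompactSpace (State d) := by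
  refine isCompact_iff_compactSpace (s := {X : Mat d | X.PosSemidef ∧ X.trace = 1}).1 ?_
  refine IsCompact.of_isClosed_subset (s := Set.pi Set.univ fun _ : Fin d =>
    Set.pi Set.univ fun _ : Fin d => Metric.closedBall (0 : ℂ) 1) ?_ isClosed_isState ?_
  · exact isCompact_univ_pi fun _ => isCompact_univ_pi fun _ => isCompact_closedBall _ _
  · intro X hX i _ j _
    simpa using State.norm_apply_le ⟨X, hX⟩ i j

instance instSecondCountableTopologyState (d : ℕ) : SecondCountableTopology (State d) :=
  inferInstanceAs
    (SecondCountableTopology ({X : Mat d | X.PosSemidef ∧ X.trace = 1} : Set (Mat d)))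

/-- The maximally mixed state. -/
noncomputable def maximallyMixed (hd : 1 ≤ d) : State d :=
  ⟨((d : ℝ)⁻¹ : ℝ) • (1 : Mat d), Matrix.PosSemidef.one.smul (by positivity), by
    have : (d : ℂ) ≠ 0 := by exact_mod_cast (by omega : d ≠ 0)
    simp [Matrix.trace_smul, this]⟩

/-- A continuous family of positive definite matrices on a compact space is bounded below by a
positive multiple of the identity. -/
lemma exists_forall_sub_smul_one_posSemidef {K : Type*} [TopologicalSpace K] [CompactSpace K]
    {f : K → Mat d} (hf : Continuous f) (hpos : ∀ k, (f k).PosDef) :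
    ∃ ε : ℝ, 0 < ε ∧ ∀ k, (f k - ε • (1 : Mat d)).PosSemidef := by
  let g : K × (Fin d → ℂ) → ℝ := fun p => (star p.2 ⬝ᵥ ((f p.1).mulVec p.2)).re
  have hg : Continuous g := by
    have : Continuous fun p : K × (Fin d → ℂ) => f p.1 := hf.comp continuous_fst
    fun_prop
  have hcomp : IsCompact ((Set.univ : Set K) ×ˢ Metric.sphere (0 : Fin d → ℂ) 1) :=
    isCompact_univ.prod (isCompact_sphere _ _)
  obtain ⟨η, hη, hle⟩ := hcomp.exists_forall_le' hg.continuousOn (a := 0) (by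
    rintro ⟨k, v⟩ ⟨-, hv⟩
    have hv0 : v ≠ 0 := by
      rintro rfl
      simp at hv
    exact (hpos k).re_dotProduct_pos hv0)
  refine ⟨η / (d + 1), by positivity, fun k => ?_⟩
  rw [posSemidef_iff_forall_re]
  refine ⟨(hpos k).1.sub (Matrix.PosSemidef.one.smul (by positivity)).1, fun v => ?_⟩
  rcases eq_or_ne v 0 with rfl | hv
  · simp
  have hn : 0 < ‖v‖ := norm_pos_iff.2 hv
  set u : Fin d → ℂ := (‖v‖⁻¹ : ℝ) • v with hu
  have hvu : v = (‖v‖ : ℂ) • u := by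
    ext i
    simp [hu, hn.ne']
  have hu1 : ‖u‖ = 1 := by rw [hu, norm_smul]; simp [hn.ne']
  have h1 : η ≤ (star u ⬝ᵥ ((f k).mulVec u)).re := hle (k, u) ⟨Set.mem_univ _, by simp [hu1]⟩
  have h2 : (star u ⬝ᵥ u).re ≤ d := by
    simp only [dotProduct, Complex.re_sum, Pi.star_apply, Complex.star_def]
    refine (Finset.sum_le_sum (g := fun _ => (1 : ℝ)) fun i _ => ?_).trans (by simp)
    rw [mul_comm, Complex.mul_conj, Complex.ofReal_re, Complex.normSq_eq_norm_sq]
    have := (norm_le_pi_norm u i).trans_eq hu1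
    exact pow_le_one₀ (norm_nonneg _) this
  have h3 : 0 ≤ (star u ⬝ᵥ ((f k - (η / (d + 1)) • (1 : Mat d)).mulVec u)).re := by
    rw [Matrix.sub_mulVec, Matrix.smul_mulVec, Matrix.one_mulVec, dotProduct_sub, dotProduct_smul,
      Complex.sub_re, Complex.real_smul, Complex.re_ofReal_mul]
    have h4 : η / (d + 1) * (star u ⬝ᵥ u).re ≤ η / (d + 1) * d := by gcongr
    have h5 : η / (d + 1) * d ≤ η := by
      rw [div_mul_eq_mul_div, div_le_iff₀ (by positivity)]
      nlinarith
    linarith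
  rw [hvu, Matrix.mulVec_smul, dotProduct_smul, star_smul, smul_dotProduct, smul_smul, smul_eq_mul,
    Complex.star_def, Complex.conj_ofReal, ← Complex.ofReal_mul, Complex.re_ofReal_mul]
  positivity

section TraceNorm

open scoped MatrixOrder

/-- A crude bound of the trace norm by the entries. -/
lemma traceNorm_le {X : Mat d} {b : ℝ} (hb : 0 ≤ b) (h : ∀ i j, ‖X i j‖ ≤ b) :
    traceNorm X ≤ d ^ 2 * b := by
  have hpsd : (CFC.abs X).PosSemidef := Matrix.nonneg_iff_posSemidef.1 (CFC.abs_nonneg X)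
  have hsq : CFC.abs X * CFC.abs X = star X * X := CFC.abs_mul_abs X
  have hdiag : ∀ i, (CFC.abs X i i).re ≤ d * b := by
    intro i
    have e := congrFun (congrFun hsq i) i
    rw [Matrix.mul_apply, Matrix.mul_apply] at e
    have e1 : (∑ j, CFC.abs X i j * CFC.abs X j i).re = ∑ j, ‖CFC.abs X i j‖ ^ 2 := by
      rw [Complex.re_sum]
      refine Finset.sum_congr rfl fun j _ => ?_
      rw [← hpsd.1.apply j i, Complex.star_def, Complex.mul_conj, Complex.ofReal_re,
        Complex.normSq_eq_norm_sq]
    have e2 : (∑ j, (star X) i j * X j i).re = ∑ j, ‖X j i‖ ^ 2 := by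
      rw [Complex.re_sum]
      refine Finset.sum_congr rfl fun j _ => ?_
      rw [Matrix.star_apply, mul_comm, Complex.star_def, Complex.mul_conj, Complex.ofReal_re,
        Complex.normSq_eq_norm_sq]
    rw [e, e2] at e1
    have h1 : ‖CFC.abs X i i‖ ^ 2 ≤ ∑ j, ‖CFC.abs X i j‖ ^ 2 :=
      Finset.single_le_sum (f := fun j => ‖CFC.abs X i j‖ ^ 2) (fun j _ => by positivity)
        (Finset.mem_univ i)
    have h2 : ∑ j, ‖X j i‖ ^ 2 ≤ d * b ^ 2 := by
      refine (Finset.sum_le_sum (g := fun _ => b ^ 2) fun j _ => ?_).trans (by simp)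
      gcongr
      exact h j i
    have hd : (1 : ℝ) ≤ d := by exact_mod_cast (Fin.pos i)
    have h3 : (d : ℝ) * b ^ 2 ≤ (d * b) ^ 2 := by
      rw [mul_pow]
      gcongr
      nlinarith
    have h4 : ‖CFC.abs X i i‖ ≤ d * b :=
      abs_le_of_sq_le_sq' (by linarith) (by positivity) |>.2
    exact (Complex.re_le_norm _).trans h4
  rw [traceNorm, Matrix.trace, Complex.re_sum]
  refine (Finset.sum_le_sum (g := fun _ => d * b) fun i _ => hdiag i).trans ?_
  simp [pow_two, mul_assoc]

end TraceNorm

/-! ### Contraction coefficients of positive trace-preserving maps -/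

/-- Positive and trace-preserving superoperators. -/
structure IsPTP (φ : Superop d) : Prop where
  posSemidef : ∀ X : Mat d, X.PosSemidef → (φ X).PosSemidef
  trace : ∀ X : Mat d, (φ X).trace = X.trace

lemma IsPTP.id : IsPTP (LinearMap.id : Superop d) := ⟨fun _ h => h, fun _ => rfl⟩

lemma IsPTP.comp {φ ψ : Superop d} (hφ : IsPTP φ) (hψ : IsPTP ψ) : IsPTP (φ ∘ₗ ψ) :=
  ⟨fun X hX => hφ.1 _ (hψ.1 X hX), fun X => (hφ.2 _).trans (hψ.2 X)⟩

/-- The image of a state under a positive trace-preserving map, as a state. -/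
def IsPTP.map {φ : Superop d} (hφ : IsPTP φ) (ρ : State d) : State d :=
  ⟨φ ρ, hφ.1 _ ρ.2.1, (hφ.2 _).trans ρ.2.2⟩

lemma IsInstrument.isPTP {A : Type*} [Fintype A] {V : A → Superop d} (hV : IsInstrument V) :
    IsPTP (∑ a, V a) := by
  refine ⟨fun X hX => ?_, fun X => ?_⟩
  · rw [LinearMap.sum_apply]
    exact Matrix.posSemidef_sum _ fun a _ => (hV.completelyPositive a).posSemidef hX
  · rw [LinearMap.sum_apply]
    exact hV.trace_preserving X

/-- `φ` contracts differences of states by the factor `c`: the difference of two output states is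
`c` times a difference of states. This is a norm-free form of the bound `c` on the Dobrushin
coefficient, and is submultiplicative under composition. -/
def Contracts (c : ℝ) (φ : Superop d) : Prop :=
  ∀ ρ σ : State d, ∃ ρ' σ' : State d,
    φ ρ - φ σ = c • ((ρ' : Mat d) - (σ' : Mat d))

lemma IsPTP.contracts_one {φ : Superop d} (hφ : IsPTP φ) : Contracts 1 φ :=
  fun ρ σ => ⟨hφ.map ρ, hφ.map σ, by simp [IsPTP.map]⟩

lemma Contracts.comp {a b : ℝ} {φ ψ : Superop d} (hφ : Contracts a φ) (hψ : Contracts b ψ) :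
    Contracts (a * b) (φ ∘ₗ ψ) := by
  intro ρ σ
  obtain ⟨ρ₁, σ₁, h₁⟩ := hψ ρ σ
  obtain ⟨ρ₂, σ₂, h₂⟩ := hφ ρ₁ σ₁
  refine ⟨ρ₂, σ₂, ?_⟩
  rw [LinearMap.comp_apply, LinearMap.comp_apply, ← map_sub, h₁, LinearMap.map_smul_of_tower,
    map_sub, h₂, smul_smul, mul_comm]

lemma Contracts.norm_sub_apply_le {c : ℝ} (hc : 0 ≤ c) {φ : Superop d} (hφ : Contracts c φ)
    (ρ σ : State d) (i j : Fin d) : ‖(φ ρ - φ σ) i j‖ ≤ 2 * c := by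
  obtain ⟨ρ', σ', h⟩ := hφ ρ σ
  rw [h, Matrix.smul_apply, norm_smul, Real.norm_of_nonneg hc, Matrix.sub_apply]
  have := (norm_sub_le ((ρ' : Mat d) i j) ((σ' : Mat d) i j)).trans
    (add_le_add (ρ'.norm_apply_le i j) (σ'.norm_apply_le i j))
  nlinarith

lemma Contracts.traceNorm_sub_le {c : ℝ} (hc : 0 ≤ c) {φ : Superop d} (hφ : Contracts c φ)
    (ρ σ : State d) : traceNorm (φ ρ - φ σ) ≤ d ^ 2 * (2 * c) :=
  traceNorm_le (by positivity) (hφ.norm_sub_apply_le hc ρ σ)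

/-- A Doeblin minorization by a multiple of the maximally mixed state gives a contraction: the
minorizing part is common to all outputs and cancels in differences. -/
lemma IsPTP.contracts_of_minorized {φ : Superop d} (hφ : IsPTP φ) {ε : ℝ} (hε : d * ε < 1)
    (h : ∀ ρ : State d, (φ ρ - ε • (1 : Mat d)).PosSemidef) : Contracts (1 - d * ε) φ := by
  have hc : 0 < 1 - d * ε := by linarith
  have key : ∀ ρ : State d, ((1 - d * ε)⁻¹ • (φ ρ - ε • (1 : Mat d))).PosSemidef ∧
      ((1 - d * ε)⁻¹ • (φ ρ - ε • (1 : Mat d))).trace = 1 := by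
    intro ρ
    refine ⟨(h ρ).smul (by positivity), ?_⟩
    rw [Matrix.trace_smul, Matrix.trace_sub, hφ.2, ρ.2.2, Matrix.trace_smul, Matrix.trace_one,
      Fintype.card_fin, Complex.real_smul, Complex.real_smul]
    have : ((1 - d * ε : ℝ) : ℂ) ≠ 0 := by exact_mod_cast hc.ne'
    rw [Complex.ofReal_inv, inv_mul_eq_one₀ this]
    push_cast
    ring
  intro ρ σ
  refine ⟨⟨_, key ρ⟩, ⟨_, key σ⟩, ?_⟩
  rw [← smul_sub, smul_smul, mul_inv_cancel₀ hc.ne', one_smul, sub_sub_sub_cancel_right]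

lemma continuous_superop (φ : Superop d) : Continuous φ :=
  LinearMap.continuous_of_finiteDimensional φ

lemma StrictlyPositive.exists_minorized {φ : Superop d} (hφ : StrictlyPositive φ) :
    ∃ ε : ℝ, 0 < ε ∧ ∀ ρ : State d, (φ ρ - ε • (1 : Mat d)).PosSemidef := by
  refine exists_forall_sub_smul_one_posSemidef
    ((continuous_superop φ).comp continuous_subtype_val) fun ρ => hφ _ ρ.2.1 ?_
  intro h0
  have := ρ.2.2
  rw [h0] at this
  simp at this

variable {Ω A : Type*}

/-! ### The cocycle along orbits -/

lemma cocycle_add [Fintype A] (θ : Ω → Ω) (T : A → Ω → Superop d) (n m : ℕ) (ω : Ω) :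
    cocycle θ T (n + m) ω = cocycle θ T n (θ^[m] ω) ∘ₗ cocycle θ T m ω := by
  induction n with
  | zero => simp [cocycle]
  | succ n ih =>
    rw [Nat.add_right_comm, cocycle, ih, cocycle, ← Function.iterate_add_apply,
      LinearMap.comp_assoc, Nat.add_right_comm]

lemma isPTP_cocycle [Fintype A] {θ : Ω → Ω} {T : A → Ω → Superop d} {ω : Ω}
    (hT : ∀ k, 1 ≤ k → IsInstrument fun a => T a (θ^[k] ω)) (n : ℕ) :
    IsPTP (cocycle θ T n ω) := by
  induction n with
  | zero => exact IsPTP.id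
  | succ n ih => exact (hT (n + 1) n.succ_pos).isPTP.comp ih

lemma measurable_superop_apply {m : MeasurableSpace Ω} {F : Ω → Superop d}
    (hF : ∀ X, Measurable fun ω => F ω X) {g : Ω → Mat d} (hg : Measurable g) :
    Measurable fun ω => F ω (g ω) := by
  have h : ∀ ω, F ω (g ω) = ∑ i, ∑ j, g ω i j • F ω (Matrix.single i j 1) := by
    intro ω
    conv_lhs => rw [Matrix.matrix_eq_sum_single (g ω)]
    simp_rw [map_sum]
    refine Finset.sum_congr rfl fun i _ => Finset.sum_congr rfl fun j _ => ?_
    rw [← map_smul, Matrix.smul_single, smul_eq_mul, mul_one]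
  simp_rw [h]
  refine Finset.measurable_sum _ fun i _ => Finset.measurable_sum _ fun j _ => ?_
  exact ((measurable_pi_apply j).comp ((measurable_pi_apply i).comp hg)).smul (hF _)

/-- The cocycle over a base point `g ω` is measurable for every `σ`-algebra for which the
instruments it is composed of are. -/
lemma measurable_cocycle {m : MeasurableSpace Ω} [Fintype A] {θ : Ω → Ω} {T : A → Ω → Superop d}
    {g : Ω → Ω} (n : ℕ)
    (h : ∀ a X j, 1 ≤ j → j ≤ n → Measurable fun ω => T a (θ^[j] (g ω)) X)
    {ρ : Ω → Mat d} (hρ : Measurable ρ) :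
    Measurable fun ω => cocycle θ T n (g ω) (ρ ω) := by
  induction n with
  | zero => exact hρ
  | succ n ih =>
    simp only [cocycle, LinearMap.comp_apply]
    refine measurable_superop_apply (F := fun ω => ∑ a, T a (θ^[n + 1] (g ω))) (fun X => ?_)
      (ih fun a X j h1 h2 => h a X j h1 (h2.trans n.le_succ))
    simp only [LinearMap.sum_apply]
    exact Finset.measurable_sum _ fun a _ => h a X (n + 1) n.succ_pos le_rfl

/-- The event that `Φ^{(n)}_ω ρ ≥ ε` for all states `ρ`. -/
def minorizedSet [Fintype A] (θ : Ω → Ω) (T : A → Ω → Superop d) (n : ℕ) (ε : ℝ) : Set Ω :=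
  {ω | ∀ ρ : State d, (cocycle θ T n ω ρ - ε • (1 : Mat d)).PosSemidef}

lemma measurableSet_preimage_minorizedSet {m : MeasurableSpace Ω} [Fintype A] {θ : Ω → Ω}
    {T : A → Ω → Superop d} {g : Ω → Ω} (n : ℕ)
    (h : ∀ a X j, 1 ≤ j → j ≤ n → Measurable fun ω => T a (θ^[j] (g ω)) X) (ε : ℝ) :
    MeasurableSet (g ⁻¹' minorizedSet θ T n ε) := by
  -- By continuity the minorization need only be tested on a countable dense set of states.
  obtain ⟨D, hDc, hD⟩ := TopologicalSpace.exists_countable_dense (State d)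
  have heq : g ⁻¹' minorizedSet θ T n ε =
      ⋂ ρ ∈ D, {ω | (cocycle θ T n (g ω) ρ - ε • (1 : Mat d)) ∈ {X : Mat d | X.PosSemidef}} := by
    ext ω
    simp only [minorizedSet, Set.mem_preimage, Set.mem_iInter]
    refine ⟨fun H ρ _ => H ρ, fun H ρ => ?_⟩
    have hcl : IsClosed {ρ : State d | (cocycle θ T n (g ω) ρ - ε • (1 : Mat d)).PosSemidef} :=
      isClosed_posSemidef.preimage
        (((continuous_superop _).comp continuous_subtype_val).sub continuous_const)
    exact (hcl.closure_subset_iff.2 fun ρ hρ => H ρ hρ) (hD ρ)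
  rw [heq]
  refine MeasurableSet.biInter hDc fun ρ _ => ?_
  exact (((measurable_cocycle n h (measurable_const (a := (ρ : Mat d)))).sub measurable_const))
    isClosed_posSemidef.measurableSet

lemma iterate_symm_iterate_add [MeasurableSpace Ω] (θ : Ω ≃ᵐ Ω) (m n : ℕ) (ω : Ω) :
    θ^[m] (θ.symm^[m + n] ω) = θ.symm^[n] ω := by
  rw [Function.iterate_add_apply]
  exact (Function.LeftInverse.iterate θ.apply_symm_apply m) _

/-- If the backward orbit visits a minorized set infinitely often, the pull-back maps
`Φ^{(n)}_{θ^{-n}ω}` contract to zero: each of infinitely many disjoint visits contributes one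
factor. -/
lemma exists_contracts_pow [MeasurableSpace Ω] [Fintype A] {θ : Ω ≃ᵐ Ω} {T : A → Ω → Superop d}
    {ω : Ω} (hT : ∀ n k, IsInstrument fun a => T a (θ^[k] (θ.symm^[n] ω))) {m : ℕ} {ε : ℝ}
    (hε : d * ε < 1) (hfreq : ∃ᶠ n in atTop, θ.symm^[n] ω ∈ minorizedSet θ T m ε) (j : ℕ) :
    ∃ N, ∀ n ≥ N, Contracts ((1 - d * ε) ^ j) (cocycle θ T n (θ.symm^[n] ω)) := by
  have hptp : ∀ n k, IsPTP (cocycle θ T k (θ.symm^[n] ω)) := fun n k =>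
    isPTP_cocycle (fun i _ => hT n i) k
  have hstep : ∀ n k, cocycle θ T (k + n) (θ.symm^[k + n] ω) =
      cocycle θ T k (θ.symm^[k] ω) ∘ₗ cocycle θ T n (θ.symm^[k + n] ω) := by
    intro n k
    rw [cocycle_add, Nat.add_comm k n, iterate_symm_iterate_add]
  induction j with
  | zero => exact ⟨0, fun n _ => by simpa using (hptp n n).contracts_one⟩
  | succ j ih =>
    obtain ⟨N, hN⟩ := ih
    obtain ⟨n, hn, hmem⟩ := frequently_atTop.1 hfreq (N + m)
    refine ⟨n, fun k hk => ?_⟩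
    obtain ⟨q, rfl⟩ : ∃ q, n = q + m := ⟨n - m, by omega⟩
    obtain ⟨r, rfl⟩ : ∃ r, k = q + m + r := ⟨k - (q + m), by omega⟩
    rw [hstep, hstep]
    have h1 := ((hN q (by omega)).comp
      ((hptp (q + m) m).contracts_of_minorized hε hmem)).comp (hptp (q + m + r) r).contracts_one
    rwa [mul_one, ← pow_succ] at h1

/-! ### Almost sure statements about the orbits -/

section Ergodic

variable [MeasurableSpace Ω] {P : Measure Ω}

/-- An ergodic map of a finite measure space visits every set of positive measure infinitely
often. -/
lemma ae_frequently_iterate_mem [IsFiniteMeasure P] {f : Ω → Ω} (hf : Ergodic f P) {E : Set Ω}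
    (hE : MeasurableSet E) (hpos : P E ≠ 0) : ∀ᵐ ω ∂P, ∃ᶠ n in atTop, f^[n] ω ∈ E := by
  set S : Set Ω := {ω | ∃ᶠ n in atTop, f^[n] ω ∈ E} with hS
  have hSm : MeasurableSet S := by
    have : S = limsup (fun n => f^[n] ⁻¹' E) atTop := by
      ext ω
      rw [mem_limsup_iff_frequently_mem]
      rfl
    rw [this]
    exact MeasurableSet.measurableSet_limsup fun n => (hf.measurable.iterate n) hE
  have hinv : f ⁻¹' S = S := by
    ext ω
    simp only [hS, Set.mem_preimage, Set.mem_ofPred_eq, ← Function.iterate_succ_apply]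
    conv_rhs => rw [← map_add_atTop_eq_nat 1, frequently_map]
  rcases hf.toPreErgodic.ae_mem_or_ae_notMem hSm hinv with h | h
  · exact h
  · exfalso
    have hp := hf.toMeasurePreserving.conservative.ae_mem_imp_frequently_image_mem
      hE.nullMeasurableSet
    refine hpos ((measure_eq_zero_iff_ae_notMem).2 ?_)
    filter_upwards [h, hp] with ω h1 h2 h3
    exact h1 (h2 h3)

lemma ae_forall_orbit {θ : Ω ≃ᵐ Ω} (hθ : MeasurePreserving θ P P) {p : Ω → Prop}
    (hp : ∀ᵐ ω ∂P, p ω) : ∀ᵐ ω ∂P, ∀ n k, p (θ^[k] (θ.symm^[n] ω)) := by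
  rw [ae_all_iff]
  intro n
  rw [ae_all_iff]
  intro k
  exact ((hθ.iterate k).comp ((hθ.symm θ).iterate n)).quasiMeasurePreserving.ae hp

variable [Fintype A] {θ : Ω ≃ᵐ Ω} {T : A → Ω → Superop d}

lemma measurableSet_minorizedSet (hθ : Measurable θ) (hT : IsRandomInstrument P T) (n : ℕ) (ε : ℝ) :
    MeasurableSet (minorizedSet θ T n ε) :=
  measurableSet_preimage_minorizedSet (g := id) n
    (fun a X j _ _ => (hT.measurable a X).comp (hθ.iterate j)) ε

/-- The thresholds `1 / ((d + 1)(k + 1))` are cofinal at zero and lie below `1 / d`. -/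
lemma StrictlyPositive.exists_mem_minorizedSet {n : ℕ} {ω : Ω}
    (h : StrictlyPositive (cocycle θ T n ω)) :
    ∃ k : ℕ, ω ∈ minorizedSet θ T n (1 / ((d + 1) * (k + 1))) := by
  obtain ⟨ε, hε, H⟩ := h.exists_minorized
  obtain ⟨k, hk⟩ := exists_nat_one_div_lt hε
  refine ⟨k, fun ρ => ?_⟩
  have hle : (1 : ℝ) / ((d + 1) * (k + 1)) ≤ ε := by
    refine le_trans ?_ hk.le
    have hk0 : (0 : ℝ) ≤ k + 1 := by positivity
    exact one_div_le_one_div_of_le (by positivity) (le_mul_of_one_le_left hk0 (by simp))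
  have : cocycle θ T n ω ρ - ((1 : ℝ) / ((d + 1) * (k + 1))) • (1 : Mat d) =
      (cocycle θ T n ω ρ - ε • (1 : Mat d)) +
        (ε - (1 : ℝ) / ((d + 1) * (k + 1))) • (1 : Mat d) := by
    rw [sub_smul]
    abel
  rw [this]
  exact (H ρ).add (Matrix.PosSemidef.one.smul (sub_nonneg.2 hle))

lemma exists_measure_minorizedSet_ne_zero [IsProbabilityMeasure P]
    (hESP : EventuallyStrictlyPositive P θ T) :
    ∃ m : ℕ, 1 ≤ m ∧ ∃ ε : ℝ, 0 < ε ∧ d * ε < 1 ∧ P (minorizedSet θ T m ε) ≠ 0 := by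
  by_contra! hcon
  have h0 : ∀ᵐ ω ∂P, ∀ n k : ℕ, ω ∉ minorizedSet θ T (n + 1) (1 / ((d + 1) * (k + 1))) := by
    rw [ae_all_iff]
    intro n
    rw [ae_all_iff]
    intro k
    refine measure_eq_zero_iff_ae_notMem.1 (hcon (n + 1) (by omega) _ (by positivity) ?_)
    rw [mul_one_div, div_lt_one (by positivity)]
    have : (0 : ℝ) ≤ k := by positivity
    have : (0 : ℝ) ≤ d := by positivity
    nlinarith
  have : ∀ᵐ _ω ∂P, False := by
    filter_upwards [h0, hESP] with ω h1 ⟨N, hN⟩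
    obtain ⟨k, hk⟩ := (hN (N + 1) (by omega)).exists_mem_minorizedSet
    exact h1 N k hk
  simp [IsProbabilityMeasure.ne_zero P] at this

/-- Almost surely some pull-back map `Φ^{(n)}_{θ^{-n}ω}` is minorized, since the probability that
`Φ^{(n)}_ω` is minorized tends to one and `θ` preserves the measure. -/
lemma ae_exists_symm_iterate_mem_minorizedSet [IsProbabilityMeasure P]
    (hθ : MeasurePreserving θ P P) (hT : IsRandomInstrument P T)
    (hESP : EventuallyStrictlyPositive P θ T) :
    ∀ᵐ ω ∂P, ∃ n : ℕ, ∃ ε : ℝ, 0 < ε ∧ θ.symm^[n] ω ∈ minorizedSet θ T n ε := by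
  set B : ℕ → Set Ω := fun n => (⋃ k : ℕ, minorizedSet θ T n (1 / ((d + 1) * (k + 1))))ᶜ with hB
  have hBm : ∀ n, MeasurableSet (B n) := fun n =>
    (MeasurableSet.iUnion fun k => measurableSet_minorizedSet θ.measurable hT n _).compl
  have hlim : Tendsto (fun n => P (B n)) atTop (𝓝 (P ∅)) := by
    refine tendsto_measure_of_ae_tendsto_indicator_of_isFiniteMeasure atTop MeasurableSet.empty
      hBm ?_
    filter_upwards [hESP] with ω ⟨N, hN⟩
    filter_upwards [eventually_ge_atTop N] with n hn
    obtain ⟨k, hk⟩ := (hN n hn).exists_mem_minorizedSet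
    simp only [hB, Set.mem_compl_iff, Set.mem_iUnion, Set.mem_empty_iff_false, iff_false, not_not]
    exact ⟨k, hk⟩
  rw [measure_empty] at hlim
  have hzero : P (⋂ n, θ.symm^[n] ⁻¹' B n) = 0 := by
    refine le_antisymm (ge_of_tendsto' hlim fun n => ?_) bot_le
    refine (measure_mono (Set.iInter_subset _ n)).trans_eq ?_
    exact ((hθ.symm θ).iterate n).measure_preimage (hBm n).nullMeasurableSet
  filter_upwards [measure_eq_zero_iff_ae_notMem.1 hzero] with ω hω
  simp only [hB, Set.mem_iInter, Set.mem_preimage, Set.mem_compl_iff, Set.mem_iUnion,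
    not_forall, not_not] at hω
  obtain ⟨n, k, h⟩ := hω
  exact ⟨n, _, by positivity, h⟩

end Ergodic

/-! ### The dynamically stationary state -/

section Stationary

variable [MeasurableSpace Ω] {P : Measure Ω} [Fintype A] {θ : Ω ≃ᵐ Ω} {T : A → Ω → Superop d}

/-- The entries of the pull-back orbit `Φ^{(n)}_{θ^{-n}ω} ρ` form Cauchy sequences once the
pull-back maps contract. -/
lemma exists_tendsto_pullback {ω : Ω} (hT : ∀ n k, IsInstrument fun a => T a (θ^[k] (θ.symm^[n] ω)))
    {c : ℝ} (hc0 : 0 ≤ c) (hc1 : c < 1)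
    (hcon : ∀ j : ℕ, ∃ N, ∀ n ≥ N, Contracts (c ^ j) (cocycle θ T n (θ.symm^[n] ω))) (ρ : State d) :
    ∃ X : Mat d, Tendsto (fun n => cocycle θ T n (θ.symm^[n] ω) ρ) atTop (𝓝 X) := by
  have hcauchy : ∀ i j, CauchySeq fun n => (cocycle θ T n (θ.symm^[n] ω) ρ) i j := by
    intro i j
    rw [Metric.cauchySeq_iff']
    intro δ hδ
    obtain ⟨k, hk⟩ := exists_pow_lt_of_lt_one (half_pos hδ) hc1
    obtain ⟨N, hN⟩ := hcon k
    refine ⟨N, fun n hn => ?_⟩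
    obtain ⟨q, rfl⟩ := Nat.exists_eq_add_of_le hn
    rw [dist_eq_norm, cocycle_add, LinearMap.comp_apply, Nat.add_comm N q, iterate_symm_iterate_add]
    have hq : IsPTP (cocycle θ T q (θ.symm^[q + N] ω)) :=
      isPTP_cocycle (fun i _ => hT (q + N) i) q
    have := (hN N le_rfl).norm_sub_apply_le (pow_nonneg hc0 k) (hq.map ρ) ρ i j
    rw [Matrix.sub_apply] at this
    exact this.trans_lt (by linarith)
  choose X hX using fun i j => cauchySeq_tendsto_of_complete (hcauchy i j)
  exact ⟨X, tendsto_pi_nhds.2 fun i => tendsto_pi_nhds.2 fun j => hX i j⟩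

lemma DynamicallyStationary.ae_eq_pullback (hθ : MeasurePreserving θ P P) {s : Ω → State d}
    (hs : DynamicallyStationary P θ T s) :
    ∀ᵐ ω ∂P, ∀ n, (s ω : Mat d) = cocycle θ T n (θ.symm^[n] ω) (s (θ.symm^[n] ω)) := by
  filter_upwards [ae_forall_orbit hθ hs.2] with ω h n
  have h1 := h n 0 n
  rw [Function.iterate_zero_apply] at h1
  have e : θ^[n] (θ.symm^[n] ω) = ω := iterate_symm_iterate_add θ n 0 ω
  rw [h1, e]

lemma ae_exists_contracts_pow [IsProbabilityMeasure P] (hθ : Ergodic θ P)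
    (hT : IsRandomInstrument P T) {m : ℕ} {ε : ℝ} (hε : d * ε < 1)
    (hpos : P (minorizedSet θ T m ε) ≠ 0) :
    ∀ᵐ ω ∂P, ∀ j : ℕ, ∃ N, ∀ n ≥ N,
      Contracts ((1 - d * ε) ^ j) (cocycle θ T n (θ.symm^[n] ω)) := by
  filter_upwards [ae_forall_orbit hθ.toMeasurePreserving hT.isInstrument,
    ae_frequently_iterate_mem hθ.symm (measurableSet_minorizedSet θ.measurable hT m ε) hpos]
    with ω h1 h2 j
  exact exists_contracts_pow h1 hε h2 j

/-- The stationary state is the pull-back limit `s(ω) = lim Φ^{(n)}_{θ^{-n}ω} ρ`. -/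
lemma exists_dynamicallyStationary (hd : 1 ≤ d) [IsProbabilityMeasure P] (hθ : Ergodic θ P)
    (hT : IsRandomInstrument P T) {m : ℕ} {ε : ℝ} (hε0 : 0 < ε) (hε : d * ε < 1)
    (hpos : P (minorizedSet θ T m ε) ≠ 0) :
    ∃ s : Ω → State d, DynamicallyStationary P θ T s := by
  classical
  set ρ₀ := maximallyMixed hd
  set x : ℕ → Ω → Mat d := fun n ω => cocycle θ T n (θ.symm^[n] ω) ρ₀ with hx
  have hgood := ae_forall_orbit hθ.toMeasurePreserving hT.isInstrument
  have hxm : ∀ n, Measurable (x n) := fun n =>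
    measurable_cocycle (g := θ.symm^[n]) n (fun a X j _ _ => (hT.measurable a X).comp
      ((θ.measurable.iterate j).comp (θ.symm.measurable.iterate n))) measurable_const
  have hlim : ∀ᵐ ω ∂P, ∃ X, Tendsto (fun n => x n ω) atTop (𝓝 X) := by
    filter_upwards [hgood, ae_exists_contracts_pow hθ hT hε hpos] with ω h1 h2
    have : 0 < d * ε := mul_pos (by exact_mod_cast hd) hε0
    exact exists_tendsto_pullback h1 (by linarith) (by linarith) h2 ρ₀
  obtain ⟨f, hfm, hf⟩ := measurable_limit_of_tendsto_metrizable_ae (L := atTop)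
    (fun n => (hxm n).aemeasurable) hlim
  have hfstate : ∀ᵐ ω ∂P, (f ω).PosSemidef ∧ (f ω).trace = 1 := by
    filter_upwards [hgood, hf] with ω h1 h2
    refine isClosed_isState.mem_of_tendsto h2 (Eventually.of_forall fun n => ?_)
    exact ((isPTP_cocycle (fun i _ => h1 n i) n).map ρ₀).2
  set s : Ω → State d := fun ω =>
    ⟨if (f ω).PosSemidef ∧ (f ω).trace = 1 then f ω else ρ₀, by
      split_ifs with h
      · exact h
      · exact ρ₀.2⟩ with hs
  have hsm : Measurable s := Measurable.subtype_mk
    (Measurable.ite (hfm isClosed_isState.measurableSet) hfm measurable_const)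
  have hslim : ∀ᵐ ω ∂P, Tendsto (fun n => x n ω) atTop (𝓝 (s ω : Mat d)) := by
    filter_upwards [hf, hfstate] with ω h1 h2
    simpa only [hs, if_pos h2] using h1
  refine ⟨s, hsm, ?_⟩
  filter_upwards [ae_forall_orbit hθ.toMeasurePreserving hslim] with ω h k
  have h1 := (((continuous_superop (cocycle θ T k ω)).tendsto _).comp (h 0 0))
  have h2 := (tendsto_add_atTop_iff_nat k).2 (h 0 k)
  simp only [Function.iterate_zero_apply] at h1 h2
  refine tendsto_nhds_unique h1 (h2.congr fun n => ?_)
  have e1 : θ.symm^[n + k] (θ^[k] ω) = θ.symm^[n] ω := by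
    rw [Function.iterate_add_apply]
    exact congrArg _ ((Function.LeftInverse.iterate θ.symm_apply_apply k) ω)
  have e2 : θ^[n] (θ.symm^[n] ω) = ω := iterate_symm_iterate_add θ n 0 ω
  simp only [hx, Function.comp_apply]
  rw [e1, Nat.add_comm n k, cocycle_add, LinearMap.comp_apply, e2]

lemma DynamicallyStationary.ae_unique (hd : 1 ≤ d) [IsProbabilityMeasure P] (hθ : Ergodic θ P)
    (hT : IsRandomInstrument P T) {m : ℕ} {ε : ℝ} (hε0 : 0 < ε) (hε : d * ε < 1)
    (hpos : P (minorizedSet θ T m ε) ≠ 0) {s s' : Ω → State d}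
    (hs : DynamicallyStationary P θ T s) (hs' : DynamicallyStationary P θ T s') : s' =ᵐ[P] s := by
  filter_upwards [hs.ae_eq_pullback hθ.toMeasurePreserving,
    hs'.ae_eq_pullback hθ.toMeasurePreserving, ae_exists_contracts_pow hθ hT hε hpos]
    with ω h1 h2 h3
  have hdε : 0 < d * ε := mul_pos (by exact_mod_cast hd) hε0
  refine Subtype.ext (Matrix.ext fun i j => ?_)
  have hle : ∀ k : ℕ, ‖(s' ω : Mat d) i j - (s ω : Mat d) i j‖ ≤ 2 * (1 - d * ε) ^ k := by
    intro k
    obtain ⟨N, hN⟩ := h3 k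
    rw [h1 N, h2 N, ← Matrix.sub_apply]
    exact (hN N le_rfl).norm_sub_apply_le (pow_nonneg (by linarith) k) _ _ i j
  have hlim : Tendsto (fun k : ℕ => 2 * (1 - d * ε) ^ k) atTop (𝓝 (2 * 0)) :=
    (tendsto_pow_atTop_nhds_zero_of_lt_one (by linarith) (by linarith)).const_mul 2
  rw [mul_zero] at hlim
  exact sub_eq_zero.1 (norm_le_zero_iff.1 (ge_of_tendsto' hlim hle))

/-- The stationary state is almost surely faithful, being the image of a state under a minorized
map. -/
lemma DynamicallyStationary.ae_sub_smul_one_posSemidef [IsProbabilityMeasure P]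
    (hθ : MeasurePreserving θ P P) (hT : IsRandomInstrument P T)
    (hESP : EventuallyStrictlyPositive P θ T) {s : Ω → State d}
    (hs : DynamicallyStationary P θ T s) :
    ∀ᵐ ω ∂P, ∃ ε : ℝ, 0 < ε ∧ ((s ω : Mat d) - ε • (1 : Mat d)).PosSemidef := by
  filter_upwards [hs.ae_eq_pullback hθ, ae_exists_symm_iterate_mem_minorizedSet hθ hT hESP]
    with ω h1 ⟨n, ε, hε, h2⟩
  refine ⟨ε, hε, ?_⟩
  rw [h1 n]
  exact h2 _

end Stationary

/-! ### Domination of quenched laws -/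

lemma State.smul_one_sub_posSemidef (ρ : State d) :
    ((d : ℝ) • (1 : Mat d) - (ρ : Mat d)).PosSemidef := by
  rw [posSemidef_iff_forall_re]
  refine ⟨(Matrix.PosSemidef.one.smul (by positivity : (0 : ℝ) ≤ d)).1.sub ρ.2.1.1, fun v => ?_⟩
  rw [Matrix.sub_mulVec, Matrix.smul_mulVec, Matrix.one_mulVec, dotProduct_sub, dotProduct_smul,
    Complex.sub_re, Complex.real_smul, Complex.re_ofReal_mul, sub_nonneg]
  have h1 : (star v ⬝ᵥ v).re = ∑ i, ‖v i‖ ^ 2 := by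
    simp only [dotProduct, Complex.re_sum, Pi.star_apply, Complex.star_def]
    refine Finset.sum_congr rfl fun i _ => ?_
    rw [mul_comm, Complex.mul_conj, Complex.ofReal_re, Complex.normSq_eq_norm_sq]
  have h2 : (star v ⬝ᵥ ((ρ : Mat d).mulVec v)).re ≤ ∑ i, ∑ j, ‖v i‖ * ‖v j‖ := by
    refine (Complex.re_le_norm _).trans ?_
    simp only [dotProduct, Matrix.mulVec, Pi.star_apply]
    refine (norm_sum_le _ _).trans (Finset.sum_le_sum fun i _ => ?_)
    rw [norm_mul, norm_star, ← Finset.mul_sum]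
    refine mul_le_mul_of_nonneg_left ?_ (norm_nonneg _)
    refine (norm_sum_le _ _).trans (Finset.sum_le_sum fun j _ => ?_)
    rw [norm_mul]
    exact mul_le_of_le_one_left (norm_nonneg _) (ρ.norm_apply_le i j)
  refine h2.trans ?_
  rw [h1, ← Finset.sum_mul_sum, ← pow_two]
  simpa using sq_sum_le_card_mul_sum_sq (s := Finset.univ) (f := fun i => ‖v i‖)

/-- If `s` is faithful then every outcome law is dominated by that of `s`: writing `s` as a proper
convex combination of `ρ` and another state exhibits `Q_s` as a mixture in which `Q_ρ` has positive
weight. -/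
lemma quenchedLaw_absolutelyContinuous [Fintype A] [MeasurableSpace A] [DiscreteMeasurableSpace A]
    (hd : 1 ≤ d) {θ : Ω → Ω} {T : A → Ω → Superop d} {ω : Ω}
    (hT : ∀ k, 1 ≤ k → IsInstrument fun a => T a (θ^[k] ω)) {ε : ℝ} (hε : 0 < ε) {s : State d}
    (hs : ((s : Mat d) - ε • (1 : Mat d)).PosSemidef) (ρ : State d) :
    quenchedLaw θ T ω ρ ≪ quenchedLaw θ T ω s := by
  have hd0 : (0 : ℝ) < d := by exact_mod_cast hd
  obtain ⟨t, ht0, ht1, htd⟩ : ∃ t : ℝ, 0 < t ∧ t < 1 ∧ t * d ≤ ε := by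
    refine ⟨ε / (d + ε), by positivity, (div_lt_one (by positivity)).2 (by linarith), ?_⟩
    rw [div_mul_eq_mul_div, div_le_iff₀ (by positivity)]
    nlinarith
  have ht1' : 0 < 1 - t := by linarith
  have hpsd : ((s : Mat d) - t • (ρ : Mat d)).PosSemidef := by
    have : (s : Mat d) - t • (ρ : Mat d) = ((s : Mat d) - ε • (1 : Mat d)) +
        (ε - t * d) • (1 : Mat d) + t • ((d : ℝ) • (1 : Mat d) - (ρ : Mat d)) := by
      rw [sub_smul, smul_sub, smul_smul]
      abel
    rw [this]
    exact (hs.add (Matrix.PosSemidef.one.smul (sub_nonneg.2 htd))).add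
      (ρ.smul_one_sub_posSemidef.smul ht0.le)
  let τ : State d := ⟨(1 - t)⁻¹ • ((s : Mat d) - t • (ρ : Mat d)), hpsd.smul (by positivity), by
    rw [Matrix.trace_smul, Matrix.trace_sub, s.2.2, Matrix.trace_smul, ρ.2.2,
      Complex.real_smul, Complex.real_smul, mul_one, ← Complex.ofReal_one, ← Complex.ofReal_sub,
      ← Complex.ofReal_mul, inv_mul_cancel₀ ht1'.ne']⟩
  have hsτ : (s : Mat d) = t • (ρ : Mat d) + (1 - t) • (τ : Mat d) := by
    simp only [τ]
    rw [smul_smul, mul_inv_cancel₀ ht1'.ne', one_smul]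
    abel
  clear_value τ
  have hρQ := quenchedLaw_spec θ T ω hT ρ
  have hτQ := quenchedLaw_spec θ T ω hT τ
  have hρP := hρQ.1
  have hτP := hτQ.1
  have hmix : HasCylinderProbs (cylinderProb θ T ω s)
      (ENNReal.ofReal t • quenchedLaw θ T ω ρ + ENNReal.ofReal (1 - t) • quenchedLaw θ T ω τ) := by
    refine ⟨⟨?_⟩, fun n a => ?_⟩
    · simp only [Measure.add_apply, Measure.smul_apply, measure_univ, smul_eq_mul, mul_one]
      rw [← ENNReal.ofReal_add ht0.le ht1'.le]
      simp
    · have hnn : ∀ σ : State d, 0 ≤ (selective θ T ω a n (σ : Mat d)).trace.re := fun σ =>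
        (Complex.nonneg_iff.1 (selective_posSemidef θ T ω hT a n σ.2.1).trace_nonneg).1
      simp only [Measure.add_apply, Measure.smul_apply, smul_eq_mul, hρQ.2, hτQ.2, cylinderProb]
      rw [← ENNReal.ofReal_mul ht0.le, ← ENNReal.ofReal_mul ht1'.le,
        ← ENNReal.ofReal_add (mul_nonneg ht0.le (hnn ρ)) (mul_nonneg ht1'.le (hnn τ))]
      congr 1
      conv_rhs => rw [hsτ]
      rw [map_add, LinearMap.map_smul_of_tower, LinearMap.map_smul_of_tower, Matrix.trace_add,
        Matrix.trace_smul, Matrix.trace_smul, Complex.add_re, Complex.real_smul, Complex.real_smul,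
        Complex.re_ofReal_mul, Complex.re_ofReal_mul]
  rw [← quenchedLaw_eq θ T ω hT s hmix]
  refine Measure.AbsolutelyContinuous.add_right ?_ _
  exact Measure.absolutelyContinuous_smul (by simpa using ht0)

/-! ### Superpolynomial decay from an approximate product inequality -/

lemma pow_mul_le_pow_of_mul_le {f : ℕ → ℝ} (hf1 : ∀ n, f n ≤ 1) {b N : ℕ} {a : ℝ} (ha : 0 ≤ a)
    (hb : 1 ≤ b) (h : ∀ n ≥ N, f (b * n) ≤ a * f n) (k : ℕ) : f (b ^ k * N) ≤ a ^ k := by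
  induction k with
  | zero => simpa using hf1 N
  | succ k ih =>
    rw [pow_succ', mul_assoc, pow_succ']
    exact (h _ (Nat.le_mul_of_pos_left N (Nat.pow_pos hb))).trans
      (mul_le_mul_of_nonneg_left ih ha)

/-- If `f (3n) ≤ f n (f n + r n)` with `r → 0`, then `f` decays faster than every power: tripling
the argument eventually gains a factor bounded away from one, whence `f → 0`, so that in fact the
gain is eventually smaller than any prescribed constant. -/
lemma exists_le_div_pow_of_approx_submultiplicative {f r : ℕ → ℝ} (hanti : Antitone f)
    (hf0 : ∀ n, 0 ≤ f n) (hf1 : ∀ n, f n ≤ 1) (hlt : f 1 < 1) (hr : Tendsto r atTop (𝓝 0))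
    (h : ∀ᶠ n in atTop, f (3 * n) ≤ f n * (f n + r n)) (p : ℕ) :
    ∃ C : ℝ, 0 < C ∧ ∀ n : ℕ, 1 ≤ n → f n ≤ C / (n : ℝ) ^ p := by
  have hzero : Tendsto f atTop (𝓝 0) := by
    have ha1 : (1 + f 1) / 2 < 1 := by linarith
    have ha0 : 0 ≤ (1 + f 1) / 2 := by linarith [hf0 1]
    have hr' : ∀ᶠ n in atTop, r n ≤ (1 - f 1) / 2 := hr.eventually_le_const (by linarith)
    obtain ⟨N, hN⟩ := eventually_atTop.1 ((h.and hr').and (eventually_ge_atTop 1))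
    have hstep : ∀ n ≥ N, f (3 * n) ≤ (1 + f 1) / 2 * f n := by
      intro n hn
      obtain ⟨⟨h1, h2⟩, h3⟩ := hN n hn
      rw [mul_comm _ (f n)]
      refine h1.trans (mul_le_mul_of_nonneg_left ?_ (hf0 n))
      linarith [hanti h3]
    rw [Metric.tendsto_atTop]
    intro δ hδ
    obtain ⟨k, hk⟩ := exists_pow_lt_of_lt_one hδ ha1
    refine ⟨3 ^ k * N, fun n hn => ?_⟩
    rw [Real.dist_0_eq_abs, abs_of_nonneg (hf0 n)]
    exact ((hanti hn).trans (pow_mul_le_pow_of_mul_le hf1 ha0 (by norm_num) hstep k)).trans_lt hk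
  have hsum : ∀ᶠ n in atTop, f n + r n ≤ ((3 : ℝ) ^ p)⁻¹ := by
    have := hzero.add hr
    rw [add_zero] at this
    exact this.eventually_le_const (by positivity)
  obtain ⟨N, hN⟩ := eventually_atTop.1 ((h.and hsum).and (eventually_ge_atTop 1))
  have hN1 : 1 ≤ N := (hN N le_rfl).2
  have hstep : ∀ n ≥ N, f (3 * n) ≤ ((3 : ℝ) ^ p)⁻¹ * f n := by
    intro n hn
    obtain ⟨⟨h1, h2⟩, -⟩ := hN n hn
    rw [mul_comm _ (f n)]
    exact h1.trans (mul_le_mul_of_nonneg_left h2 (hf0 n))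
  have hN0 : (0 : ℝ) < N := by exact_mod_cast hN1
  refine ⟨(3 * N) ^ p, by positivity, fun n hn => ?_⟩
  have hn0 : (0 : ℝ) < n := by exact_mod_cast hn
  rw [← div_pow]
  rcases lt_or_ge n N with hlt | hge
  · refine (hf1 n).trans (one_le_pow₀ ?_)
    rw [one_le_div hn0]
    have : (n : ℝ) ≤ N := by exact_mod_cast hlt.le
    linarith
  · set k := Nat.log 3 (n / N) with hk
    have hq : n / N ≠ 0 := (Nat.div_pos hge hN1).ne'
    have hk1 : 3 ^ k * N ≤ n :=
      (Nat.mul_le_mul_right N (Nat.pow_log_le_self 3 hq)).trans (Nat.div_mul_le_self n N)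
    have hk2 : n < 3 ^ (k + 1) * N :=
      (Nat.div_lt_iff_lt_mul hN1).1 (Nat.lt_pow_succ_log_self (by norm_num) _)
    have hk3 : (n : ℝ) ≤ 3 ^ k * (3 * N) := by
      have : (n : ℝ) ≤ ((3 ^ (k + 1) * N : ℕ) : ℝ) := by exact_mod_cast hk2.le
      push_cast at this
      rw [pow_succ] at this
      linarith
    refine ((hanti hk1).trans
      (pow_mul_le_pow_of_mul_le hf1 (by positivity) (by norm_num) hstep k)).trans ?_
    rw [inv_pow, ← pow_mul, mul_comm p k, pow_mul, ← inv_pow]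
    refine pow_le_pow_left₀ (by positivity) ?_ p
    rw [le_div_iff₀ hn0, inv_mul_le_iff₀ (by positivity)]
    exact hk3

/-! ### Correlation bounds -/

section Correlation

variable {mΩ : MeasurableSpace Ω} {P : Measure Ω} [IsProbabilityMeasure P]

lemma memLp_two_of_mem_unitInterval {U : Ω → ℝ} (hU : Measurable U)
    (h : ∀ ω, U ω ∈ Set.Icc (0 : ℝ) 1) : MemLp U 2 P :=
  MemLp.of_bound hU.aestronglyMeasurable 1 (Eventually.of_forall fun ω => by
    rw [Real.norm_of_nonneg (h ω).1]
    exact (h ω).2)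

lemma variance_le_integral_of_mem_unitInterval {U : Ω → ℝ} (hU : Measurable U)
    (h : ∀ ω, U ω ∈ Set.Icc (0 : ℝ) 1) : Var[U; P] ≤ ∫ ω, U ω ∂P := by
  have hmem := memLp_two_of_mem_unitInterval (P := P) hU h
  refine (variance_le_expectation_sq hU.aestronglyMeasurable).trans ?_
  refine integral_mono hmem.integrable_sq (hmem.integrable (by norm_num)) fun ω => ?_
  exact pow_le_of_le_one (h ω).1 (h ω).2 two_ne_zero

lemma covariance_eq_zero_of_variance_eq_zero {U V : Ω → ℝ} (hU : MemLp U 2 P)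
    (h : Var[U; P] = 0) : cov[U, V; P] = 0 := by
  rw [covariance]
  refine integral_eq_zero_of_ae ?_
  filter_upwards [ae_eq_integral_of_variance_eq_zero hU h] with ω hω
  simp [hω]

end Correlation

/-- For variables valued in `[0, 1]` the maximal correlation coefficient bounds the defect of
multiplicativity of the expectation by the *square roots* of the expectations. -/
lemma integral_mul_le_of_maxCorr {m₁ m₂ mΩ : MeasurableSpace Ω} {P : Measure Ω}
    [IsProbabilityMeasure P] (h₁ : m₁ ≤ mΩ) (h₂ : m₂ ≤ mΩ)
    {U V : Ω → ℝ} (hU : Measurable[m₁] U) (hV : Measurable[m₂] V)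
    (hU01 : ∀ ω, U ω ∈ Set.Icc (0 : ℝ) 1) (hV01 : ∀ ω, V ω ∈ Set.Icc (0 : ℝ) 1)
    {r : ℝ} (hr0 : 0 ≤ r)
    (hr : maxCorr P m₁ m₂ ≤ ENNReal.ofReal r) :
    ∫ ω, U ω * V ω ∂P ≤
      (∫ ω, U ω ∂P) * (∫ ω, V ω ∂P) + r * (√(∫ ω, U ω ∂P) * √(∫ ω, V ω ∂P)) := by
  have hUm : Measurable U := hU.mono h₁ le_rfl
  have hVm : Measurable V := hV.mono h₂ le_rfl
  have hUL := memLp_two_of_mem_unitInterval (P := P) hUm hU01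
  have hVL := memLp_two_of_mem_unitInterval (P := P) hVm hV01
  have hcov : cov[U, V; P] = ∫ ω, U ω * V ω ∂P - (∫ ω, U ω ∂P) * (∫ ω, V ω ∂P) :=
    covariance_eq_sub hUL hVL
  suffices cov[U, V; P] ≤ r * (√(∫ ω, U ω ∂P) * √(∫ ω, V ω ∂P)) by linarith
  rcases (variance_nonneg U P).eq_or_lt with hU0 | hU0
  · rw [covariance_eq_zero_of_variance_eq_zero hUL hU0.symm]
    positivity
  rcases (variance_nonneg V P).eq_or_lt with hV0 | hV0
  · rw [covariance_comm, covariance_eq_zero_of_variance_eq_zero hVL hV0.symm]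
    positivity
  have hcorr : |cov[U, V; P]| / (√Var[U; P] * √Var[V; P]) ≤ r := by
    rw [← ENNReal.ofReal_le_ofReal_iff hr0]
    refine le_trans ?_ hr
    unfold maxCorr
    exact le_iSup_of_le U <| le_iSup_of_le V <| le_iSup_of_le hU <| le_iSup_of_le hV <|
      le_iSup_of_le hUL <| le_iSup_of_le hVL <| le_iSup_of_le hU0 <| le_iSup_of_le hV0 le_rfl
  rw [div_le_iff₀ (by positivity)] at hcorr
  refine (le_abs_self _).trans (hcorr.trans ?_)
  gcongr
  · exact variance_le_integral_of_mem_unitInterval hUm hU01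
  · exact variance_le_integral_of_mem_unitInterval hVm hV01

/-! ### Block contraction factors -/

open Classical in
/-- The contraction factor of a single block of length `m`: it is `1 - dε` if the cocycle over the
block is minorized by `ε`, and `1` otherwise. -/
noncomputable def singleFactor [Fintype A] (θ : Ω → Ω) (T : A → Ω → Superop d) (m : ℕ) (ε : ℝ)
    (ω : Ω) : ℝ :=
  if ω ∈ minorizedSet θ T m ε then 1 - d * ε else 1

/-- The product of the contraction factors of the first `J` blocks of length `m`. -/
noncomputable def blockFactor [Fintype A] (θ : Ω → Ω) (T : A → Ω → Superop d) (m : ℕ) (ε : ℝ)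
    (J : ℕ) (ω : Ω) : ℝ :=
  ∏ j ∈ Finset.range J, singleFactor θ T m ε (θ^[j * m] ω)

section BlockFactor

variable [Fintype A] {θ : Ω → Ω} {T : A → Ω → Superop d} {m : ℕ} {ε : ℝ}

lemma blockFactor_mem_unitInterval (hε0 : 0 ≤ ε) (hε : d * ε < 1) (J : ℕ) (ω : Ω) :
    blockFactor θ T m ε J ω ∈ Set.Icc (0 : ℝ) 1 := by
  have hdε : 0 ≤ d * ε := by positivity
  refine ⟨Finset.prod_nonneg fun j _ => ?_, Finset.prod_le_one (fun j _ => ?_) fun j _ => ?_⟩ <;>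
    unfold singleFactor <;> split_ifs <;> linarith

lemma blockFactor_add (J K : ℕ) (ω : Ω) :
    blockFactor θ T m ε (J + K) ω =
      blockFactor θ T m ε J ω * blockFactor θ T m ε K (θ^[J * m] ω) := by
  simp only [blockFactor, Finset.prod_range_add, ← Function.iterate_add_apply, Nat.add_mul,
    Nat.add_comm]

lemma blockFactor_antitone (hε0 : 0 ≤ ε) (hε : d * ε < 1) (ω : Ω) :
    Antitone fun J => blockFactor θ T m ε J ω := by
  refine antitone_nat_of_succ_le fun J => ?_
  rw [blockFactor_add]
  exact mul_le_of_le_one_right (blockFactor_mem_unitInterval hε0 hε J ω).1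
    (blockFactor_mem_unitInterval hε0 hε 1 _).2

/-- The middle block is dropped, leaving a gap between the two remaining factors. -/
lemma blockFactor_three_mul_le (hε0 : 0 ≤ ε) (hε : d * ε < 1) (J : ℕ) (ω : Ω) :
    blockFactor θ T m ε (3 * J) ω ≤
      blockFactor θ T m ε J ω * blockFactor θ T m ε J (θ^[2 * J * m] ω) := by
  have : 3 * J = 2 * J + J := by ring
  rw [this, blockFactor_add]
  exact mul_le_mul_of_nonneg_right (blockFactor_antitone hε0 hε ω (by omega))
    (blockFactor_mem_unitInterval hε0 hε J _).1

lemma measurable_blockFactor {mΩ : MeasurableSpace Ω} (N J : ℕ)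
    (h : ∀ a X i, N + 1 ≤ i → i ≤ N + J * m → Measurable fun ω => T a (θ^[i] ω) X) :
    Measurable fun ω => blockFactor θ T m ε J (θ^[N] ω) := by
  unfold blockFactor
  refine Finset.measurable_prod _ fun j hj => ?_
  have hj' : j + 1 ≤ J := Finset.mem_range.1 hj
  have hset : MeasurableSet ((θ^[j * m + N]) ⁻¹' minorizedSet θ T m ε) := by
    refine measurableSet_preimage_minorizedSet m (fun a X i h1 h2 => ?_) ε
    simp only [← Function.iterate_add_apply]
    refine h a X _ (by omega) ?_
    have := Nat.mul_le_mul_right m hj'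
    rw [Nat.add_mul] at this
    omega
  simp only [← Function.iterate_add_apply]
  unfold singleFactor
  exact Measurable.ite hset measurable_const measurable_const

lemma contracts_blockFactor {ω : Ω} (hT : ∀ k, IsInstrument fun a => T a (θ^[k] ω))
    (hε : d * ε < 1) (J : ℕ) : Contracts (blockFactor θ T m ε J ω) (cocycle θ T (J * m) ω) := by
  induction J with
  | zero =>
    simpa [blockFactor, cocycle] using (IsPTP.id (d := d)).contracts_one
  | succ J ih =>
    have hptp : IsPTP (cocycle θ T m (θ^[J * m] ω)) := by
      refine isPTP_cocycle (fun k _ => ?_) m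
      rw [← Function.iterate_add_apply]
      exact hT _
    rw [Nat.add_mul, Nat.one_mul, Nat.add_comm (J * m) m, cocycle_add, blockFactor,
      Finset.prod_range_succ, mul_comm]
    refine Contracts.comp ?_ ih
    unfold singleFactor
    split_ifs with h
    · exact hptp.contracts_of_minorized hε h
    · exact hptp.contracts_one

lemma contracts_cocycle_blockFactor {ω : Ω} (hT : ∀ k, IsInstrument fun a => T a (θ^[k] ω))
    (hε : d * ε < 1) (n : ℕ) : Contracts (blockFactor θ T m ε (n / m) ω) (cocycle θ T n ω) := by
  have hptp : IsPTP (cocycle θ T (n % m) (θ^[n / m * m] ω)) := by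
    refine isPTP_cocycle (fun k _ => ?_) _
    rw [← Function.iterate_add_apply]
    exact hT _
  have h := hptp.contracts_one.comp (contracts_blockFactor (m := m) hT hε (n / m))
  rwa [one_mul, ← cocycle_add, Nat.mod_add_div'] at h

end BlockFactor

/-! ### Decay of the expected block factor under mixing -/

section Mixing

variable [mΩ : MeasurableSpace Ω] {P : Measure Ω} {θ : Ω ≃ᵐ Ω}
  {T : A → Ω → Superop d} {m : ℕ} {ε : ℝ}

lemma perm_zpow_natCast_apply (i : ℕ) (ω : Ω) :
    ((θ.toEquiv : Equiv.Perm Ω) ^ (i : ℤ)) ω = θ^[i] ω := by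
  rw [zpow_natCast, ← Equiv.Perm.iterate_eq_pow]
  rfl

lemma measurable_instrumentSigma (a : A) (X : Mat d) (i : ℕ) :
    Measurable[instrumentSigma θ T i] fun ω => T a (θ^[i] ω) X := by
  have h : Measurable[MeasurableSpace.comap
      (fun ω => T a (((θ.toEquiv : Equiv.Perm Ω) ^ (i : ℤ)) ω) X) inferInstance]
      fun ω => T a (((θ.toEquiv : Equiv.Perm Ω) ^ (i : ℤ)) ω) X := comap_measurable _
  simp only [perm_zpow_natCast_apply] at h
  refine h.mono ?_ le_rfl
  unfold instrumentSigma
  simp only [perm_zpow_natCast_apply]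
  exact le_iSup₂_of_le a X le_rfl

variable [Fintype A]

lemma instrumentSigma_le (hT : IsRandomInstrument P T) (j : ℤ) : instrumentSigma θ T j ≤ mΩ := by
  refine iSup₂_le fun a X => Measurable.comap_le ((hT.measurable a X).comp ?_)
  obtain ⟨n, rfl | rfl⟩ := j.eq_nat_or_neg
  · rw [funext (perm_zpow_natCast_apply n)]
    exact θ.measurable.iterate n
  · have : ⇑((θ.toEquiv : Equiv.Perm Ω) ^ (-(n : ℤ))) = θ.symm^[n] := by
      rw [zpow_neg, zpow_natCast, ← inv_pow, ← Equiv.Perm.iterate_eq_pow]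
      rfl
    rw [this]
    exact θ.symm.measurable.iterate n

lemma integrable_blockFactor [IsProbabilityMeasure P] (hT : IsRandomInstrument P T) (hε0 : 0 ≤ ε)
    (hε : d * ε < 1) (J : ℕ) : Integrable (blockFactor θ T m ε J) P :=
  (memLp_two_of_mem_unitInterval (measurable_blockFactor 0 J fun a X i _ _ =>
      (hT.measurable a X).comp (θ.measurable.iterate i))
    (blockFactor_mem_unitInterval hε0 hε J)).integrable (by norm_num)

lemma integral_blockFactor_one_lt [IsProbabilityMeasure P] (hd : 1 ≤ d)
    (hT : IsRandomInstrument P T) (hε0 : 0 < ε)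
    (hpos : P (minorizedSet θ T m ε) ≠ 0) : ∫ ω, blockFactor θ T m ε 1 ω ∂P < 1 := by
  have hE := measurableSet_minorizedSet (P := P) θ.measurable hT m ε
  have heq : blockFactor θ T m ε 1 =
      fun ω => 1 - (minorizedSet θ T m ε).indicator (fun _ => d * ε) ω := by
    funext ω
    by_cases h : ω ∈ minorizedSet θ T m ε <;> simp [blockFactor, singleFactor, h]
  rw [heq, integral_sub (integrable_const _) ((integrable_const _).indicator hE),
    integral_indicator_const _ hE]
  have h1 : 0 < P.real (minorizedSet θ T m ε) := by
    rw [measureReal_def]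
    exact ENNReal.toReal_pos hpos (measure_ne_top _ _)
  have hd0 : (0 : ℝ) < d := by exact_mod_cast hd
  simp only [integral_const, probReal_univ, smul_eq_mul, mul_one]
  have : 0 < P.real (minorizedSet θ T m ε) * (d * ε) := by positivity
  linarith

lemma integral_blockFactor_three_mul_le [IsProbabilityMeasure P] (hθ : MeasurePreserving θ P P)
    (hT : IsRandomInstrument P T) (hm : 1 ≤ m) (hε0 : 0 ≤ ε) (hε : d * ε < 1) {J : ℕ} (hJ : 1 ≤ J)
    (hfin : rhoMixing P θ T (J * m) ≠ ∞) :
    ∫ ω, blockFactor θ T m ε (3 * J) ω ∂P ≤ (∫ ω, blockFactor θ T m ε J ω ∂P) *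
      (∫ ω, blockFactor θ T m ε J ω ∂P + (rhoMixing P θ T (J * m)).toReal) := by
  have hJm : 1 ≤ J * m := Nat.mul_pos hJ hm
  have hUm : Measurable[pastSigma θ T (J * m : ℕ)] (blockFactor θ T m ε J) := by
    refine measurable_blockFactor (mΩ := pastSigma θ T (J * m : ℕ)) 0 J fun a X i _ h2 => ?_
    refine (measurable_instrumentSigma a X i).mono ?_ le_rfl
    exact le_iSup₂_of_le (i : ℤ) (by exact_mod_cast (by omega : i ≤ J * m)) le_rfl
  have hVm : Measurable[futureSigma θ T ((J * m : ℕ) + (J * m : ℕ))]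
      fun ω => blockFactor θ T m ε J (θ^[2 * J * m] ω) := by
    refine measurable_blockFactor (mΩ := futureSigma θ T ((J * m : ℕ) + (J * m : ℕ)))
      (2 * J * m) J fun a X i h1 _ => ?_
    refine (measurable_instrumentSigma a X i).mono ?_ le_rfl
    have : J * m + J * m ≤ i := by
      rw [Nat.mul_assoc] at h1
      omega
    exact le_iSup₂_of_le (i : ℤ) (by exact_mod_cast this) le_rfl
  have hcorr : maxCorr P (pastSigma θ T (J * m : ℕ)) (futureSigma θ T ((J * m : ℕ) + (J * m : ℕ)))
      ≤ ENNReal.ofReal (rhoMixing P θ T (J * m)).toReal := by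
    rw [ENNReal.ofReal_toReal hfin]
    exact le_iSup₂_of_le (J * m) hJm le_rfl
  have hV : ∫ ω, blockFactor θ T m ε J (θ^[2 * J * m] ω) ∂P = ∫ ω, blockFactor θ T m ε J ω ∂P := by
    have hmp := hθ.iterate (2 * J * m)
    have hmeas := (integrable_blockFactor (P := P) (m := m) (θ := θ) hT hε0 hε J).1
    rw [← hmp.map_eq] at hmeas
    rw [← integral_map hmp.measurable.aemeasurable hmeas, hmp.map_eq]
  have hmain := integral_mul_le_of_maxCorr (P := P)
    (iSup₂_le fun j _ => instrumentSigma_le hT j) (iSup₂_le fun j _ => instrumentSigma_le hT j)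
    hUm hVm (blockFactor_mem_unitInterval hε0 hε J)
    (fun ω => blockFactor_mem_unitInterval hε0 hε J _) ENNReal.toReal_nonneg hcorr
  have hnn : 0 ≤ ∫ ω, blockFactor θ T m ε J ω ∂P :=
    integral_nonneg fun ω => (blockFactor_mem_unitInterval hε0 hε J ω).1
  rw [hV, Real.mul_self_sqrt hnn] at hmain
  refine le_trans (integral_mono (integrable_blockFactor hT hε0 hε _) ?_
    (blockFactor_three_mul_le hε0 hε J)) (hmain.trans_eq (by ring))
  have hVL := memLp_two_of_mem_unitInterval (P := P)
    (hVm.mono (iSup₂_le fun j _ => instrumentSigma_le hT j) le_rfl)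
    (fun ω => blockFactor_mem_unitInterval hε0 hε J _)
  have hUL := memLp_two_of_mem_unitInterval (P := P)
    (hUm.mono (iSup₂_le fun j _ => instrumentSigma_le hT j) le_rfl)
    (blockFactor_mem_unitInterval hε0 hε J)
  exact hUL.integrable_mul hVL

lemma exists_integral_blockFactor_le [IsProbabilityMeasure P] (hd : 1 ≤ d)
    (hθ : MeasurePreserving θ P P) (hT : IsRandomInstrument P T) (hm : 1 ≤ m) (hε0 : 0 < ε)
    (hε : d * ε < 1) (hpos : P (minorizedSet θ T m ε) ≠ 0)
    (hmix : Tendsto (rhoMixing P θ T) atTop (𝓝 0)) (p : ℕ) :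
    ∃ C : ℝ, 0 < C ∧ ∀ J : ℕ, 1 ≤ J → ∫ ω, blockFactor θ T m ε J ω ∂P ≤ C / (J : ℝ) ^ p := by
  have hmix' : Tendsto (fun J => rhoMixing P θ T (J * m)) atTop (𝓝 0) :=
    hmix.comp (tendsto_id.atTop_mul_const' hm)
  refine exists_le_div_pow_of_approx_submultiplicative
    (r := fun J => (rhoMixing P θ T (J * m)).toReal) ?_ ?_ ?_
    (integral_blockFactor_one_lt hd hT hε0 hpos) ?_ ?_ p
  · intro J K hJK
    exact integral_mono (integrable_blockFactor hT hε0.le hε K)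
      (integrable_blockFactor hT hε0.le hε J) fun ω => blockFactor_antitone hε0.le hε ω hJK
  · exact fun J => integral_nonneg fun ω => (blockFactor_mem_unitInterval hε0.le hε J ω).1
  · intro J
    refine (integral_mono (integrable_blockFactor hT hε0.le hε J) (integrable_const (1 : ℝ))
      fun ω => (blockFactor_mem_unitInterval hε0.le hε J ω).2).trans_eq (by simp)
  · exact (ENNReal.tendsto_toReal ENNReal.zero_ne_top).comp hmix'
  · filter_upwards [eventually_ge_atTop 1, hmix'.eventually_lt_const ENNReal.zero_lt_top]
      with J hJ hfin
    exact integral_blockFactor_three_mul_le hθ hT hm hε0.le hε hJ hfin.ne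

/-! ### Annealed forgetting -/

lemma forgettingCoeff_le [IsProbabilityMeasure P] (hθ : MeasurePreserving θ P P)
    (hT : IsRandomInstrument P T) (hε0 : 0 ≤ ε) (hε : d * ε < 1) {s : Ω → State d}
    (hs : DynamicallyStationary P θ T s) (ϑ : Ω → State d) (n : ℕ) :
    forgettingCoeff P θ T s ϑ n ≤
      ENNReal.ofReal (d ^ 2 * (2 * ∫ ω, blockFactor θ T m ε (n / m) ω ∂P)) := by
  have hbound : forgettingCoeff P θ T s ϑ n ≤
      ∫⁻ ω, ENNReal.ofReal (d ^ 2 * (2 * blockFactor θ T m ε (n / m) ω)) ∂P := by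
    refine lintegral_mono_ae ?_
    filter_upwards [hs.2, ae_forall_orbit hθ hT.isInstrument] with ω h1 h2
    rw [← h1 n]
    exact ENNReal.ofReal_le_ofReal ((contracts_cocycle_blockFactor (h2 0) hε n).traceNorm_sub_le
      (blockFactor_mem_unitInterval hε0 hε _ ω).1 _ _)
  refine hbound.trans_eq ?_
  rw [← ofReal_integral_eq_lintegral_ofReal
    (((integrable_blockFactor hT hε0 hε _).const_mul _).const_mul _)
    (Eventually.of_forall fun ω => ?_), integral_const_mul, integral_const_mul]
  have := (blockFactor_mem_unitInterval (θ := θ) (T := T) (m := m) hε0 hε (n / m) ω).1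
  simp only [Pi.zero_apply]
  positivity

lemma exists_forgettingCoeff_le [IsProbabilityMeasure P] (hd : 1 ≤ d)
    (hθ : MeasurePreserving θ P P) (hT : IsRandomInstrument P T) (hm : 1 ≤ m) (hε0 : 0 < ε)
    (hε : d * ε < 1) (hpos : P (minorizedSet θ T m ε) ≠ 0)
    (hmix : Tendsto (rhoMixing P θ T) atTop (𝓝 0)) {s : Ω → State d}
    (hs : DynamicallyStationary P θ T s) (p : ℕ) :
    ∃ C : ℝ, 0 < C ∧ ∀ ϑ : Ω → State d, ∀ n : ℕ, 1 ≤ n →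
      forgettingCoeff P θ T s ϑ n ≤ ENNReal.ofReal (C / (n : ℝ) ^ p) := by
  obtain ⟨C, hC, h⟩ := exists_integral_blockFactor_le hd hθ hT hm hε0 hε hpos hmix p
  have hd0 : (0 : ℝ) < d := by exact_mod_cast hd
  have hm0 : (0 : ℝ) < m := by exact_mod_cast hm
  refine ⟨d ^ 2 * (2 * ((C + 1) * (2 * m) ^ p)), by positivity, fun ϑ n hn => ?_⟩
  refine (forgettingCoeff_le (m := m) hθ hT hε0.le hε hs ϑ n).trans (ENNReal.ofReal_le_ofReal ?_)
  rw [mul_div_assoc, mul_div_assoc, mul_div_assoc]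
  gcongr
  have hn0 : (0 : ℝ) < n := by exact_mod_cast hn
  rcases Nat.eq_zero_or_pos (n / m) with hz | hJ
  -- For `n < m` no block is complete, and `1 ≤ (2m / n) ^ p`.
  · have hnm : n < m := by
      rcases Nat.div_eq_zero_iff.1 hz with h0 | h0
      · omega
      · exact h0
    have hnm' : (n : ℝ) ≤ m := by exact_mod_cast hnm.le
    rw [hz]
    have h1 : (1 : ℝ) ≤ (2 * m) ^ p / n ^ p := by
      rw [← div_pow]
      exact one_le_pow₀ ((one_le_div hn0).2 (by linarith))
    simp only [blockFactor, Finset.range_zero, Finset.prod_empty, integral_const, probReal_univ,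
      smul_eq_mul, mul_one]
    nlinarith
  · have hJ0 : (0 : ℝ) < (n / m : ℕ) := by exact_mod_cast hJ
    have hle : (n : ℝ) ≤ (n / m : ℕ) * (2 * m) := by
      have h1 : n < (n / m + 1) * m := by
        rw [Nat.add_mul, Nat.one_mul]
        exact Nat.lt_div_mul_add hm
      have h2 : (n / m + 1) * m ≤ n / m * (2 * m) := by nlinarith
      exact_mod_cast h1.le.trans h2
    refine (h _ hJ).trans ?_
    rw [div_le_iff₀ (by positivity)]
    have h2 : (n : ℝ) ^ p ≤ ((n / m : ℕ) : ℝ) ^ p * (2 * m) ^ p := by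
      rw [← mul_pow]
      gcongr
    have h3 : 1 ≤ (2 * (m : ℝ)) ^ p / n ^ p * ((n / m : ℕ) : ℝ) ^ p := by
      rw [div_mul_eq_mul_div, one_le_div (by positivity), mul_comm]
      exact h2
    rw [mul_assoc]
    nlinarith

/-- The rate `C / n ^ p` with `p δ / (2 + δ) ≥ 2` is summable at the exponent `δ / (2 + δ)`. -/
lemma annealedForgetting_of_polynomial {δ : ℝ} (hδ : 0 < δ) {s : Ω → State d}
    (hs : DynamicallyStationary P θ T s)
    (h : ∀ p : ℕ, ∃ C : ℝ, 0 < C ∧ ∀ ϑ : Ω → State d, ∀ n : ℕ, 1 ≤ n →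
      forgettingCoeff P θ T s ϑ n ≤ ENNReal.ofReal (C / (n : ℝ) ^ p)) :
    AnnealedForgetting P θ T δ s := by
  set q : ℝ := δ / (2 + δ) with hq
  have hq0 : 0 < q := by positivity
  obtain ⟨p, hp⟩ := exists_nat_gt (2 / q)
  rw [div_lt_iff₀ hq0] at hp
  obtain ⟨C, hC, hle⟩ := h p
  refine ⟨hs, fun n => C / (n : ℝ) ^ p, fun n => by positivity, ?_, fun ϑ _ n hn => hle ϑ n hn⟩
  have hsum : Summable fun n : ℕ => C ^ q * (1 / ((n + 1 : ℕ) : ℝ) ^ (p * q)) :=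
    ((summable_nat_add_iff 1).2
      (Real.summable_one_div_nat_rpow.2 (by linarith : 1 < (p : ℝ) * q))).mul_left _
  refine hsum.congr fun n => ?_
  rw [Real.div_rpow hC.le (by positivity), ← Real.rpow_natCast_mul (by positivity), mul_one_div]

end Mixing

end DisorderedInstrument

open DisorderedInstrument in
theorem mainTheorem2 {Ω : Type*} [MeasurableSpace Ω] (P : Measure Ω) [IsProbabilityMeasure P]
    (θ : Ω ≃ᵐ Ω) (hθ : Ergodic θ P)
    (d : ℕ) (hd : 1 ≤ d)
    {A : Type*} [Fintype A] [MeasurableSpace A] [DiscreteMeasurableSpace A]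
    (T : A → Ω → DisorderedInstrument.Superop d)
    (hT : DisorderedInstrument.IsRandomInstrument P T)
    (hESP : DisorderedInstrument.EventuallyStrictlyPositive P θ T) :
    ∃ s : Ω → DisorderedInstrument.State d,
      DisorderedInstrument.DynamicallyStationary P θ T s ∧
      (∀ s' : Ω → DisorderedInstrument.State d,
        DisorderedInstrument.DynamicallyStationary P θ T s' → s' =ᵐ[P] s) ∧
      (∀ ϑ : Ω → DisorderedInstrument.State d, Measurable ϑ →
        ∀ᵐ ω ∂P, DisorderedInstrument.quenchedLaw θ T ω (ϑ ω) ≪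
          DisorderedInstrument.quenchedLaw θ T ω (s ω)) ∧
      (Tendsto (DisorderedInstrument.rhoMixing P θ T) atTop (𝓝 0) →
        (∀ δ : ℝ, 0 < δ → DisorderedInstrument.AnnealedForgetting P θ T δ s) ∧
        ∀ p : ℕ, ∃ C : ℝ, 0 < C ∧
          ∀ ϑ : Ω → DisorderedInstrument.State d, Measurable ϑ → ∀ n : ℕ, 1 ≤ n →
            DisorderedInstrument.forgettingCoeff P θ T s ϑ n ≤
              ENNReal.ofReal (C / (n : ℝ) ^ p)) := by
  have hmp := hθ.toMeasurePreserving
  obtain ⟨m, hm, ε, hε0, hε, hpos⟩ := exists_measure_minorizedSet_ne_zero hESP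
  obtain ⟨s, hs⟩ := exists_dynamicallyStationary hd hθ hT hε0 hε hpos
  refine ⟨s, hs, fun s' hs' => hs.ae_unique hd hθ hT hε0 hε hpos hs', fun ϑ _ => ?_,
    fun hmix => ?_⟩
  · filter_upwards [ae_forall_orbit hmp hT.isInstrument,
      hs.ae_sub_smul_one_posSemidef hmp hT hESP] with ω h1 ⟨η, hη, h2⟩
    exact quenchedLaw_absolutelyContinuous hd (fun k _ => h1 0 k) hη h2 _
  · have hpoly := exists_forgettingCoeff_le hd hmp hT hm hε0 hε hpos hmix hs
    refine ⟨fun δ hδ => annealedForgetting_of_polynomial hδ hs hpoly, fun p => ?_⟩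
    obtain ⟨C, hC, h⟩ := hpoly p
    exact ⟨C, hC, fun ϑ _ => h ϑ⟩
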